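/- **Theorem (Convergence of the energy).** Let $\rho,\alpha,\beta,\gamma,\mu,k_1,k_2,L>0$ with $\alpha_1:=\alpha-\gamma^2\beta>0$. Let $u^1,u^2,w^1,w^2\in C^1([0,\infty);C^3[0,L])$ solve $$\rho \dot w^1-\alpha u^1_x+\gamma\beta u^2_x=0,\quad \mu\dot w^2-\beta u^2_x+\gamma\beta u^1_x=0,\quad \dot u^1-w^1_x=0,\quad \dot u^2-w^2_x=0\qquad (0<x<L,\ t>0)$$ with $w^1(0,t)=w^2(0,t)=0$, $(\alpha u^1-\gamma\beta u^2)(L,t)=-k_1w^1(L,t)$, $(\beta u^2-\gamma\beta u^1)(L,t)=-k_2w^2(L,t)$ for $t>0$, and let $$E(t)=\frac12\int_0^L\left(\rho|w^1|^2+\mu|w^2|^2+\alpha|u^1|^2-2\gamma\beta u^1u^2+\beta|u^2|^2\right)dx .$$ For $N=0,1,2,\dots$ put $h=\frac{L}{N+1}$, $x_j=jh$ $(0\le j\le N+1)$, and for grid functions $U_{j+\frac12}=\frac{U_j+U_{j+1}}2$, $\delta_xU_{j+\frac12}=\frac{U_{j+1}-U_j}h$ $(0\le j\le N)$. For every $N$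 let $(u^1_j,u^2_j,w^1_j,w^2_j)(t)$, $0\le j\le N+1$, be continuous on $[0,\infty)$, differentiable for $t>0$, and solve the ORFD system $$\dot u^1_{j+\frac12}-\delta_xw^1_{j+\frac12}=0,\quad \dot u^2_{j+\frac12}-\delta_xw^2_{j+\frac12}=0,$$ $$\rho\dot w^1_{j+\frac12}-\alpha\delta_xu^1_{j+\frac12}+\gamma\beta\delta_xu^2_{j+\frac12}=0,\quad \mu\dot w^2_{j+\frac12}-\beta\delta_xu^2_{j+\frac12}+\gamma\beta\delta_xu^1_{j+\frac12}=0\qquad (0\le j\le N,\ t>0),$$ $$w^1_0=w^2_0=0,\quad \alpha u^1_{N+1}-\gamma\beta u^2_{N+1}=-k_1w^1_{N+1},\quad \beta u^2_{N+1}-\gamma\beta u^1_{N+1}=-k_2w^2_{N+1}\qquad (t>0),$$ with exact initial data $(u^1_j,u^2_j,w^1_j,w^2_j)(0)=(u^1,u^2,w^1,w^2)(x_j,0)$. Put $$E_h^{\rm ORFD}(t)=\frac h2\sum_{j=0}^N\left(\rho|w^1_{j+\frac12}|^2+\mu|w^2_{j+\frac12}|^2+\beta|\gamma u^1_{j+\frac12}-u^2_{j+\frac12}|^2+\alpha_1|u^1_{j+\frac12}|^2\right)$$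 and assume that $E_h^{\rm ORFD}(0)\to E(0)$ as $h\to0$. Then: 1. For every $N$ the errors $\theta^k_j(t)=u^k(x_j,t)-u^k_j(t)$, $\eta^k_j(t)=w^k(x_j,t)-w^k_j(t)$ $(k=1,2)$ vanish at $t=0$ and satisfy, for $t>0$, the ORFD system (with $\theta^k,\eta^k$ in place of $u^k,w^k$, the same boundary conditions) in which the right-hand sides $0$ of the four equations are replaced, in the order displayed, by $r^1_{j+\frac12},r^2_{j+\frac12},s^1_{j+\frac12},s^2_{j+\frac12}$, where for every $t>0$ and $0\le j\le N$ there are $\xi_1,\dots,\xi_8\in[x_j,x_{j+1}]$ such that, all functions being evaluated at time $t$, $$s^1_{j+\frac12}=h^2\left(\tfrac\rho8\dot w^1_{xx}(\xi_1)-\tfrac\alpha{24}u^1_{xxx}(\xi_2)+\tfrac{\gamma\beta}{24}u^2_{xxx}(\xi_3)\right),\quad s^2_{j+\frac12}=h^2\left(\tfrac\mu8\dot w^2_{xx}(\xi_4)-\tfrac\beta{24}u^2_{xxx}(\xi_3)+\tfrac{\gamma\beta}{24}u^1_{xxx}(\xi_2)\right),$$ $$r^1_{j+\frac12}=h^2\left(\tfrac18\dot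 u^1_{xx}(\xi_5)-\tfrac1{24}w^1_{xxx}(\xi_6)\right),\quad r^2_{j+\frac12}=h^2\left(\tfrac18\dot u^2_{xx}(\xi_7)-\tfrac1{24}w^2_{xxx}(\xi_8)\right).$$ 2. There is a constant $c>0$, independent of $h$ and $t$ (it may depend on $k_1,k_2$, the other constants and the solution of the PDE system), such that for all $N$ and all $t\ge0$ $$\left|E_h^{\rm ORFD}(t)-E(t)\right|\le\left|E_h^{\rm ORFD}(0)-E(0)\right|+c\,h^{3/2}\sqrt t .$$ 3. $E_h^{\rm ORFD}\to E$ uniformly on $[0,\infty)$ as $h\to0$, that is, as $N\to\infty$. -/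

import Mathlib

open Set Filter Topology

namespace Piezo

/-- The constants of a magnetizable piezoelectric beam of length `L` with feedback gains `k₁`, `k₂`. -/
structure Beam where
  ρ : ℝ
  α : ℝ
  β : ℝ
  γ : ℝ
  μ : ℝ
  k₁ : ℝ
  k₂ : ℝ
  L : ℝ
  ρ_pos : 0 < ρ
  α_pos : 0 < α
  β_pos : 0 < β
  γ_pos : 0 < γ
  μ_pos : 0 < μ
  k₁_pos : 0 < k₁
  k₂_pos : 0 < k₂
  L_pos : 0 < L
  α₁_pos : 0 < α - γ ^ 2 * β

/-- The reduced stiffness `α₁ = α - γ²β`. -/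
def Beam.α₁ (b : Beam) : ℝ := b.α - b.γ ^ 2 * b.β

/-! ### The continuous model -/

/-- `f x t` belongs to `C¹([0,∞); C³[0,L])`. The Banach space `C³[0,L]` is, through
`φ ↦ (φ, φ', φ'', φ''')`, a closed subspace of `C[0,L]⁴`; hence the condition is that every
`f(·,t)` is of class `C³` on `[0,L]` and that, for `i = 0, 1, 2, 3`, the map `t ↦ ∂ₓⁱ f(·,t)` is
continuously differentiable from `[0,∞)` to the Banach space `C[0,L]`. -/
def IsC1C3 (L : ℝ) (f : ℝ → ℝ → ℝ) : Prop :=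
  (∀ t ∈ Ici (0 : ℝ), ContDiffOn ℝ 3 (fun x => f x t) (Icc 0 L)) ∧
  ∀ i ≤ 3, ∃ F : ℝ → C(Icc (0 : ℝ) L, ℝ), ContDiffOn ℝ 1 F (Ici 0) ∧
    ∀ t ∈ Ici (0 : ℝ), ∀ x : Icc (0 : ℝ) L,
      F t x = iteratedDerivWithin i (fun y => f y t) (Icc 0 L) x

/-- Four functions of `(x, t)`: strain and charge gradient `u₁ = v_x`, `u₂ = p_x`, velocity and
current `w₁ = v_t`, `w₂ = p_t`. -/
structure Field where
  u₁ : ℝ → ℝ → ℝ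
  u₂ : ℝ → ℝ → ℝ
  w₁ : ℝ → ℝ → ℝ
  w₂ : ℝ → ℝ → ℝ

/-- All four components are in `C¹([0,∞); C³[0,L])`. -/
structure Field.IsC1C3 (b : Beam) (f : Field) : Prop where
  u₁ : Piezo.IsC1C3 b.L f.u₁
  u₂ : Piezo.IsC1C3 b.L f.u₂
  w₁ : Piezo.IsC1C3 b.L f.w₁
  w₂ : Piezo.IsC1C3 b.L f.w₂

/-- The first-order form of the closed-loop beam equations. -/
structure Field.SolvesPDE (b : Beam) (f : Field) : Prop where
  momentum₁ : ∀ x ∈ Ioo 0 b.L, ∀ t > 0,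
    b.ρ * deriv (fun τ => f.w₁ x τ) t - b.α * deriv (fun y => f.u₁ y t) x
      + b.γ * b.β * deriv (fun y => f.u₂ y t) x = 0
  momentum₂ : ∀ x ∈ Ioo 0 b.L, ∀ t > 0,
    b.μ * deriv (fun τ => f.w₂ x τ) t - b.β * deriv (fun y => f.u₂ y t) x
      + b.γ * b.β * deriv (fun y => f.u₁ y t) x = 0
  compat₁ : ∀ x ∈ Ioo 0 b.L, ∀ t > 0,
    deriv (fun τ => f.u₁ x τ) t - deriv (fun y => f.w₁ y t) x = 0
  compat₂ : ∀ x ∈ Ioo 0 b.L, ∀ t > 0,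
    deriv (fun τ => f.u₂ x τ) t - deriv (fun y => f.w₂ y t) x = 0
  clamped₁ : ∀ t > 0, f.w₁ 0 t = 0
  clamped₂ : ∀ t > 0, f.w₂ 0 t = 0
  feedback₁ : ∀ t > 0,
    b.α * f.u₁ b.L t - b.γ * b.β * f.u₂ b.L t = -b.k₁ * f.w₁ b.L t
  feedback₂ : ∀ t > 0,
    b.β * f.u₂ b.L t - b.γ * b.β * f.u₁ b.L t = -b.k₂ * f.w₂ b.L t

/-- The energy `E(t) = ½ ∫₀ᴸ (C₁ w · w + C₂ u · u) dx` with `C₁ = diag(ρ, μ)` and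
`C₂ = [[α, -γβ], [-γβ, β]]`. -/
noncomputable def Field.energy (b : Beam) (f : Field) (t : ℝ) : ℝ :=
  1 / 2 * ∫ x in (0 : ℝ)..b.L,
    (b.ρ * f.w₁ x t ^ 2 + b.μ * f.w₂ x t ^ 2
      + (b.α * f.u₁ x t ^ 2 - 2 * (b.γ * b.β) * (f.u₁ x t * f.u₂ x t) + b.β * f.u₂ x t ^ 2))

/-! ### The semi-discretized model -/

/-- The mesh size `h = L / (N + 1)`. -/
noncomputable def Beam.h (b : Beam) (N : ℕ) : ℝ := b.L / (N + 1)

/-- The nodes `x_j = j h`, `j = 0, …, N + 1`. -/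
noncomputable def Beam.node (b : Beam) (N : ℕ) (j : Fin (N + 2)) : ℝ := (j : ℕ) * b.h N

/-- The average `U_{j+1/2} = (U_j + U_{j+1}) / 2`, `j = 0, …, N`. -/
noncomputable def avg {N : ℕ} (U : Fin (N + 2) → ℝ) (j : Fin (N + 1)) : ℝ :=
  (U j.castSucc + U j.succ) / 2

/-- The difference quotient `δₓ U_{j+1/2} = (U_{j+1} - U_j) / h`, `j = 0, …, N`. -/
noncomputable def Beam.δ (b : Beam) {N : ℕ} (U : Fin (N + 2) → ℝ) (j : Fin (N + 1)) : ℝ :=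
  (U j.succ - U j.castSucc) / b.h N

/-- Four grid functions on the nodes `x_0, …, x_{N+1}`. -/
structure GridData (N : ℕ) where
  u₁ : Fin (N + 2) → ℝ
  u₂ : Fin (N + 2) → ℝ
  w₁ : Fin (N + 2) → ℝ
  w₂ : Fin (N + 2) → ℝ

/-- The zero grid functions. -/
def GridData.zero (N : ℕ) : GridData N where
  u₁ := fun _ => 0
  u₂ := fun _ => 0
  w₁ := fun _ => 0
  w₂ := fun _ => 0

/-- The values of `f(·, t)` at the nodes. -/
noncomputable def Field.sample (b : Beam) (f : Field) (N : ℕ) (t : ℝ) : GridData N where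
  u₁ := fun j => f.u₁ (b.node N j) t
  u₂ := fun j => f.u₂ (b.node N j) t
  w₁ := fun j => f.w₁ (b.node N j) t
  w₂ := fun j => f.w₂ (b.node N j) t

/-- Right-hand sides at the midpoints `x_{j+1/2}`, `j = 0, …, N`. -/
structure Residual (N : ℕ) where
  r₁ : ℝ → Fin (N + 1) → ℝ
  r₂ : ℝ → Fin (N + 1) → ℝ
  s₁ : ℝ → Fin (N + 1) → ℝ
  s₂ : ℝ → Fin (N + 1) → ℝ

/-- Vanishing right-hand sides. -/
def Residual.zero (N : ℕ) : Residual N where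
  r₁ := fun _ _ => 0
  r₂ := fun _ _ => 0
  s₁ := fun _ _ => 0
  s₂ := fun _ _ => 0

/-- `g` solves the order-reduced finite difference (ORFD) system with right-hand side `R` and
initial data `g₀`. -/
structure SolvesORFD (b : Beam) {N : ℕ} (R : Residual N) (g₀ : GridData N)
    (g : ℝ → GridData N) : Prop where
  cont : ∀ j, ContinuousOn (fun t => (g t).u₁ j) (Ici 0) ∧
    ContinuousOn (fun t => (g t).u₂ j) (Ici 0) ∧
    ContinuousOn (fun t => (g t).w₁ j) (Ici 0) ∧
    ContinuousOn (fun t => (g t).w₂ j) (Ici 0)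
  diff : ∀ j, ∀ t > 0, DifferentiableAt ℝ (fun t => (g t).u₁ j) t ∧
    DifferentiableAt ℝ (fun t => (g t).u₂ j) t ∧
    DifferentiableAt ℝ (fun t => (g t).w₁ j) t ∧
    DifferentiableAt ℝ (fun t => (g t).w₂ j) t
  compat₁ : ∀ t > 0, ∀ j : Fin (N + 1),
    deriv (fun τ => avg (g τ).u₁ j) t - b.δ (g t).w₁ j = R.r₁ t j
  compat₂ : ∀ t > 0, ∀ j : Fin (N + 1),
    deriv (fun τ => avg (g τ).u₂ j) t - b.δ (g t).w₂ j = R.r₂ t j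
  momentum₁ : ∀ t > 0, ∀ j : Fin (N + 1),
    b.ρ * deriv (fun τ => avg (g τ).w₁ j) t - b.α * b.δ (g t).u₁ j
      + b.γ * b.β * b.δ (g t).u₂ j = R.s₁ t j
  momentum₂ : ∀ t > 0, ∀ j : Fin (N + 1),
    b.μ * deriv (fun τ => avg (g τ).w₂ j) t - b.β * b.δ (g t).u₂ j
      + b.γ * b.β * b.δ (g t).u₁ j = R.s₂ t j
  clamped₁ : ∀ t > 0, (g t).w₁ 0 = 0
  clamped₂ : ∀ t > 0, (g t).w₂ 0 = 0
  feedback₁ : ∀ t > 0,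
    b.α * (g t).u₁ (Fin.last (N + 1)) - b.γ * b.β * (g t).u₂ (Fin.last (N + 1))
      = -b.k₁ * (g t).w₁ (Fin.last (N + 1))
  feedback₂ : ∀ t > 0,
    b.β * (g t).u₂ (Fin.last (N + 1)) - b.γ * b.β * (g t).u₁ (Fin.last (N + 1))
      = -b.k₂ * (g t).w₂ (Fin.last (N + 1))
  init : g 0 = g₀

/-- The discretized energy `E_h`. -/
noncomputable def GridData.energy (b : Beam) {N : ℕ} (g : GridData N) : ℝ :=
  b.h N / 2 * ∑ j : Fin (N + 1),
    (b.ρ * |avg g.w₁ j| ^ 2 + b.μ * |avg g.w₂ j| ^ 2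
      + b.β * |b.γ * avg g.u₁ j - avg g.u₂ j| ^ 2 + b.α₁ * |avg g.u₁ j| ^ 2)

/-! ### The error -/

/-- The error functions `(θ₁, θ₂, η₁, η₂)`: nodal values of `f` minus the discrete solution. -/
noncomputable def errorFun (b : Beam) (f : Field) {N : ℕ} (g : ℝ → GridData N) (t : ℝ) :
    GridData N where
  u₁ := fun j => (f.sample b N t).u₁ j - (g t).u₁ j
  u₂ := fun j => (f.sample b N t).u₂ j - (g t).u₂ j
  w₁ := fun j => (f.sample b N t).w₁ j - (g t).w₁ j
  w₂ := fun j => (f.sample b N t).w₂ j - (g t).w₂ j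

/-- The `i`-th space derivative on `[0,L]`. -/
noncomputable def Beam.Dx (b : Beam) (i : ℕ) (φ : ℝ → ℝ) (ξ : ℝ) : ℝ :=
  iteratedDerivWithin i φ (Icc 0 b.L) ξ

/-- `R` consists of the Taylor remainders left when the nodal values of `f` are inserted in the
homogeneous ORFD system. -/
def Residual.IsTruncationError (b : Beam) (f : Field) {N : ℕ} (R : Residual N) : Prop :=
  ∀ t > 0, ∀ j : Fin (N + 1),
    ∃ ξ : Fin 8 → ℝ, (∀ i, ξ i ∈ Icc (b.node N j.castSucc) (b.node N j.succ)) ∧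
      R.s₁ t j = b.h N ^ 2 *
        (b.ρ / 8 * b.Dx 2 (fun x => deriv (fun τ => f.w₁ x τ) t) (ξ 0)
          - b.α / 24 * b.Dx 3 (fun x => f.u₁ x t) (ξ 1)
          + b.γ * b.β / 24 * b.Dx 3 (fun x => f.u₂ x t) (ξ 2)) ∧
      R.s₂ t j = b.h N ^ 2 *
        (b.μ / 8 * b.Dx 2 (fun x => deriv (fun τ => f.w₂ x τ) t) (ξ 3)
          - b.β / 24 * b.Dx 3 (fun x => f.u₂ x t) (ξ 2)
          + b.γ * b.β / 24 * b.Dx 3 (fun x => f.u₁ x t) (ξ 1)) ∧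
      R.r₁ t j = b.h N ^ 2 *
        (1 / 8 * b.Dx 2 (fun x => deriv (fun τ => f.u₁ x τ) t) (ξ 4)
          - 1 / 24 * b.Dx 3 (fun x => f.w₁ x t) (ξ 5)) ∧
      R.r₂ t j = b.h N ^ 2 *
        (1 / 8 * b.Dx 2 (fun x => deriv (fun τ => f.u₂ x τ) t) (ξ 6)
          - 1 / 24 * b.Dx 3 (fun x => f.w₂ x t) (ξ 7))

end Piezo

/-! The two energies are compared through their dissipation. Both are nonincreasing, and both lose
energy only through the velocity traces at x = L, at the rate k₁w₁² + k₂w₂². So the change of E_h -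
E is the integral of a difference of squares of traces. By Cauchy–Schwarz it is at most the square
root of the total dissipation of the error times the square root of the total dissipation of the two
systems; the latter is bounded by the initial energies.

The error solves the ORFD system with a Taylor remainder of size O(h²) as right-hand side
(`Lift.residual_eq`, `Lift.solvesORFD_errorFun`). Its energy identity bounds both its energy and its
total dissipation by O((h²t)²), so E_h - E changes by O(h²t) (`abs_energy_sub_le`).

This needs third space derivatives bounded uniformly in time. The equation U_t = A U_x, with A
constant and invertible, turns them into third time derivatives, which form again a classical
solution of the same closed loop (`Lift.isSol_three`). The energies of such a solution and of its
time derivative do not increase, and a Sobolev inequality makes it bounded (`IsSol.exists_norm_le`).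

For long times the bound O(h²t) is useless, but the multiplier x gives E(t) = O(1/t)
(`IsSol.exists_decay`). At T = 1/h the energy E and the change O(h²T) are both O(h), and after T
monotonicity keeps the two energies small, up to the initial discrepancy. Together the error beyond
that discrepancy is O(min(h²t, h)) (`exists_energy_bound`): the minimum is at most the geometric
mean h^{3/2}√t, and at most h, which gives uniform convergence. -/

namespace Piezo

/-! ### Calculus in the Banach algebra `C[0,L]` -/

/-- The Banach algebra `C[0,L]`. -/
abbrev Beam.X (b : Beam) : Type := C(Icc (0 : ℝ) b.L, ℝ)

/-- Evaluation at the point of `[0,L]` closest to `x`. -/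
noncomputable def Beam.at (b : Beam) (x : ℝ) : b.X →L[ℝ] ℝ :=
  ContinuousMap.evalCLM ℝ (projIcc 0 b.L b.L_pos.le x)

theorem Beam.at_apply (b : Beam) (x : ℝ) (φ : b.X) :
    b.at x φ = φ (projIcc 0 b.L b.L_pos.le x) := rfl

@[simp] theorem Beam.at_mul (b : Beam) (x : ℝ) (φ ψ : b.X) :
    b.at x (φ * ψ) = b.at x φ * b.at x ψ := rfl

theorem Beam.at_coe (b : Beam) (x : Icc (0 : ℝ) b.L) (φ : b.X) : b.at x φ = φ x := by
  rw [Beam.at_apply, projIcc_val]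

theorem Beam.continuous_at (b : Beam) (φ : b.X) : Continuous fun x => b.at x φ :=
  φ.continuous.comp continuous_projIcc

theorem Beam.abs_at_le (b : Beam) (x : ℝ) (φ : b.X) : |b.at x φ| ≤ ‖φ‖ :=
  φ.norm_coe_le_norm _

/-- The primitive `φ ↦ ∫₀ˣ φ`. -/
noncomputable def Beam.prim (b : Beam) (x : ℝ) : b.X →L[ℝ] ℝ :=
  LinearMap.mkContinuous
    { toFun := fun φ => ∫ y in (0 : ℝ)..x, b.at y φ
      map_add' := fun φ ψ => by
        simp only [map_add]
        exact intervalIntegral.integral_add ((b.continuous_at φ).intervalIntegrable _ _)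
          ((b.continuous_at ψ).intervalIntegrable _ _)
      map_smul' := fun c φ => by
        simp only [map_smul, intervalIntegral.integral_smul, RingHom.id_apply] }
    |x| (fun φ => by
      have := intervalIntegral.norm_integral_le_of_norm_le_const (a := 0) (b := x)
        (f := fun y => b.at y φ) (C := ‖φ‖) (fun y _ => b.abs_at_le y φ)
      simpa [mul_comm] using this)

theorem Beam.prim_apply (b : Beam) (x : ℝ) (φ : b.X) :
    b.prim x φ = ∫ y in (0 : ℝ)..x, b.at y φ := rfl

theorem Beam.prim_mono (b : Beam) {φ ψ : b.X} (h : ∀ x, b.at x φ ≤ b.at x ψ) :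
    b.prim b.L φ ≤ b.prim b.L ψ :=
  intervalIntegral.integral_mono b.L_pos.le ((b.continuous_at φ).intervalIntegrable _ _)
    ((b.continuous_at ψ).intervalIntegrable _ _) h

theorem Beam.prim_nonneg (b : Beam) {φ : b.X} (h : ∀ x, 0 ≤ b.at x φ) : 0 ≤ b.prim b.L φ := by
  simpa using b.prim_mono (φ := 0) (ψ := φ) (by simpa using h)

/-- `ψ` is the space derivative of `φ`. -/
def Beam.HasDx (b : Beam) (φ ψ : b.X) : Prop :=
  ∀ x ∈ Icc 0 b.L, b.at x φ - b.at 0 φ = b.prim x ψ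

theorem Beam.hasDx_of_hasDerivAt (b : Beam) {φ ψ : b.X}
    (h : ∀ x ∈ Ioo 0 b.L, HasDerivAt (fun y => b.at y φ) (b.at x ψ) x) : b.HasDx φ ψ := by
  intro x hx
  rw [b.prim_apply, intervalIntegral.integral_eq_sub_of_hasDerivAt_of_le hx.1
    (b.continuous_at φ).continuousOn (fun y hy => h y ⟨hy.1, hy.2.trans_le hx.2⟩)
    ((b.continuous_at ψ).intervalIntegrable _ _)]

theorem Beam.HasDx.hasDerivAt {b : Beam} {φ ψ : b.X} (h : b.HasDx φ ψ) {x : ℝ}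
    (hx : x ∈ Ioo 0 b.L) : HasDerivAt (fun y => b.at y φ) (b.at x ψ) x := by
  have h1 : HasDerivAt (fun y => b.at 0 φ + b.prim y ψ) (b.at x ψ) x :=
    (intervalIntegral.integral_hasDerivAt_right ((b.continuous_at ψ).intervalIntegrable _ _)
      ((b.continuous_at ψ).stronglyMeasurableAtFilter _ _) (b.continuous_at ψ).continuousAt).const_add _
  refine h1.congr_of_eventuallyEq ?_
  filter_upwards [Ioo_mem_nhds hx.1 hx.2] with y hy
  rw [← h y (Ioo_subset_Icc_self hy)]; ring

theorem Beam.ext_of_Ioo (b : Beam) {φ ψ : b.X} (h : ∀ x ∈ Ioo 0 b.L, b.at x φ = b.at x ψ) :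
    φ = ψ := by
  have h1 : EqOn (fun x => b.at x φ) (fun x => b.at x ψ) (closure (Ioo 0 b.L)) :=
    EqOn.closure h (b.continuous_at φ) (b.continuous_at ψ)
  rw [closure_Ioo b.L_pos.ne] at h1
  ext x
  simpa [Beam.at_coe] using h1 x.2

theorem Beam.HasDx.unique {b : Beam} {φ ψ χ : b.X} (h : b.HasDx φ ψ) (h' : b.HasDx φ χ) :
    ψ = χ :=
  b.ext_of_Ioo fun _ hx => (h.hasDerivAt hx).unique (h'.hasDerivAt hx)

theorem Beam.HasDx.add {b : Beam} {φ ψ φ' ψ' : b.X} (h : b.HasDx φ ψ) (h' : b.HasDx φ' ψ') :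
    b.HasDx (φ + φ') (ψ + ψ') := by
  intro x hx
  rw [map_add, map_add, map_add, ← h x hx, ← h' x hx]; ring

theorem Beam.HasDx.smul {b : Beam} {φ ψ : b.X} (h : b.HasDx φ ψ) (c : ℝ) :
    b.HasDx (c • φ) (c • ψ) := by
  intro x hx
  simp only [map_smul, smul_eq_mul, ← h x hx]; ring

theorem Beam.HasDx.sub {b : Beam} {φ ψ φ' ψ' : b.X} (h : b.HasDx φ ψ) (h' : b.HasDx φ' ψ') :
    b.HasDx (φ - φ') (ψ - ψ') := by
  intro x hx
  rw [map_sub, map_sub, map_sub, ← h x hx, ← h' x hx]; ring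

theorem Beam.HasDx.mul {b : Beam} {φ ψ φ' ψ' : b.X} (h : b.HasDx φ ψ) (h' : b.HasDx φ' ψ') :
    b.HasDx (φ * φ') (ψ * φ' + φ * ψ') :=
  b.hasDx_of_hasDerivAt fun _ hx => (h.hasDerivAt hx).mul (h'.hasDerivAt hx)

theorem Beam.HasDx.prim_eq {b : Beam} {φ ψ : b.X} (h : b.HasDx φ ψ) :
    b.prim b.L ψ = b.at b.L φ - b.at 0 φ :=
  (h b.L (right_mem_Icc.2 b.L_pos.le)).symm

/-- Differentiation in time commutes with differentiation in space. -/
theorem Beam.HasDx.time_deriv {b : Beam} {φ ψ : ℝ → b.X} {φ' ψ' : b.X} {t : ℝ}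
    (h : ∀ᶠ τ in 𝓝 t, b.HasDx (φ τ) (ψ τ)) (hφ : HasDerivAt φ φ' t) (hψ : HasDerivAt ψ ψ' t) :
    b.HasDx φ' ψ' := by
  intro x hx
  -- In its integrated form the relation `HasDx` equates two continuous linear functionals of φ and
  -- ψ, so it can be differentiated in time without an interchange of limits.
  have h1 : HasDerivAt (fun τ => b.at x (φ τ) - b.at 0 (φ τ)) (b.at x φ' - b.at 0 φ') t :=
    ((b.at x).hasFDerivAt.comp_hasDerivAt t hφ).sub ((b.at 0).hasFDerivAt.comp_hasDerivAt t hφ)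
  have h2 : HasDerivAt (fun τ => b.prim x (ψ τ)) (b.prim x ψ') t :=
    (b.prim x).hasFDerivAt.comp_hasDerivAt t hψ
  exact h1.unique (h2.congr_of_eventuallyEq (h.mono fun τ hτ => hτ x hx))

/-- The function `x ↦ x` on `[0,L]`. -/
def Beam.idX (b : Beam) : b.X := ⟨Subtype.val, continuous_subtype_val⟩

theorem Beam.at_idX (b : Beam) {x : ℝ} (hx : x ∈ Icc 0 b.L) : b.at x b.idX = x := by
  rw [Beam.at_apply, projIcc_of_mem _ hx]; rfl

theorem Beam.hasDx_idX (b : Beam) : b.HasDx b.idX 1 := by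
  intro x hx
  rw [b.at_idX hx, b.at_idX (left_mem_Icc.2 b.L_pos.le), b.prim_apply]
  simp [Beam.at_apply]

/-- A one-dimensional Sobolev inequality. -/
theorem Beam.HasDx.sq_le {b : Beam} {φ ψ : b.X} (h : b.HasDx φ ψ) {x : ℝ} (hx : x ∈ Icc 0 b.L) :
    b.L * b.at x φ ^ 2 ≤ (1 + b.L) * b.prim b.L (φ * φ) + b.L * b.prim b.L (ψ * ψ) := by
  have hm := h.mul h
  set S := b.prim b.L (φ * φ) + b.prim b.L (ψ * ψ) with hS
  -- The oscillation of φ² is at most ∫ 2|φψ| ≤ ∫ (φ² + ψ²). Averaging φ(x)² - S ≤ φ(y)² over y then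
  -- yields the claim.
  have key : ∀ z ∈ Icc 0 b.L, ∀ y ∈ Icc 0 b.L, z ≤ y →
      |b.at y φ ^ 2 - b.at z φ ^ 2| ≤ S := by
    intro z hz y hy hzy
    have e : b.at y φ ^ 2 - b.at z φ ^ 2 = ∫ s in z..y, b.at s (ψ * φ + φ * ψ) := by
      have h1 := hm y hy
      have h2 := hm z hz
      rw [b.prim_apply] at h1 h2
      have h3 := intervalIntegral.integral_interval_sub_left
        (μ := MeasureTheory.volume)
        ((b.continuous_at (ψ * φ + φ * ψ)).intervalIntegrable 0 y)
        ((b.continuous_at (ψ * φ + φ * ψ)).intervalIntegrable 0 z)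
      rw [← h3, ← h1, ← h2]; simp only [b.at_mul]; ring
    have hS' : S = ∫ s in (0 : ℝ)..b.L, b.at s (φ * φ + ψ * ψ) := by
      rw [hS, ← map_add]; rfl
    rw [e, hS']
    have hc := b.continuous_at (φ * φ + ψ * ψ)
    calc |∫ s in z..y, b.at s (ψ * φ + φ * ψ)|
        ≤ ∫ s in z..y, |b.at s (ψ * φ + φ * ψ)| :=
          intervalIntegral.abs_integral_le_integral_abs hzy
      _ ≤ ∫ s in z..y, b.at s (φ * φ + ψ * ψ) := by
          refine intervalIntegral.integral_mono hzy
            ((b.continuous_at _).abs.intervalIntegrable _ _) (hc.intervalIntegrable _ _) ?_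
          intro s
          simp only [map_add, b.at_mul]
          rw [abs_le]
          constructor <;> nlinarith [sq_nonneg (b.at s φ - b.at s ψ), sq_nonneg (b.at s φ + b.at s ψ)]
      _ ≤ ∫ s in (0 : ℝ)..b.L, b.at s (φ * φ + ψ * ψ) := by
          refine intervalIntegral.integral_mono_interval hz.1 hzy hy.2 ?_ (hc.intervalIntegrable _ _)
          refine Eventually.of_forall fun s => ?_
          simp only [map_add, b.at_mul, Pi.zero_apply]
          exact add_nonneg (mul_self_nonneg _) (mul_self_nonneg _)
  have hy : ∀ y ∈ Icc 0 b.L, b.at x φ ^ 2 - S ≤ b.at y (φ * φ) := by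
    intro y hy
    rw [b.at_mul]
    rcases le_total x y with hxy | hxy
    · linarith [(abs_le.1 (key x hx y hy hxy)).1]
    · linarith [(abs_le.1 (key y hy x hx hxy)).2]
  have := intervalIntegral.integral_mono_on (μ := MeasureTheory.volume) b.L_pos.le
    (continuous_const.intervalIntegrable 0 b.L) ((b.continuous_at (φ * φ)).intervalIntegrable _ _) hy
  rw [intervalIntegral.integral_const, smul_eq_mul, ← b.prim_apply] at this
  nlinarith

/-! ### Classical solutions as curves in `C[0,L]⁴` -/

/-- Quadruples `(u₁, u₂, w₁, w₂)` of continuous functions. -/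
abbrev Beam.Q (b : Beam) : Type := Fin 4 → b.X

/-- The matrix `A` of the first order system `U_t = A U_x`. -/
noncomputable def Beam.mat (b : Beam) : Fin 4 → Fin 4 → ℝ :=
  ![![0, 0, 1, 0], ![0, 0, 0, 1],
    ![b.α / b.ρ, -(b.γ * b.β) / b.ρ, 0, 0], ![-(b.γ * b.β) / b.μ, b.β / b.μ, 0, 0]]

/-- The matrix `A` acting on quadruples of functions. -/
noncomputable def Beam.A (b : Beam) : b.Q →L[ℝ] b.Q :=
  ContinuousLinearMap.pi fun i => ∑ j, b.mat i j • ContinuousLinearMap.proj (φ := fun _ => b.X) j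

theorem Beam.A_apply (b : Beam) (v : b.Q) (i : Fin 4) : b.A v i = ∑ j, b.mat i j • v j := by
  simp [Beam.A]

theorem Beam.A_zero (b : Beam) (v : b.Q) : b.A v 0 = v 2 := by
  simp [Beam.A_apply, Beam.mat, Fin.sum_univ_four]

theorem Beam.A_one (b : Beam) (v : b.Q) : b.A v 1 = v 3 := by
  simp [Beam.A_apply, Beam.mat, Fin.sum_univ_four]

theorem Beam.A_two (b : Beam) (v : b.Q) :
    b.A v 2 = (b.α / b.ρ) • v 0 + (-(b.γ * b.β) / b.ρ) • v 1 := by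
  simp [Beam.A_apply, Beam.mat, Fin.sum_univ_four]

theorem Beam.A_three (b : Beam) (v : b.Q) :
    b.A v 3 = (-(b.γ * b.β) / b.μ) • v 0 + (b.β / b.μ) • v 1 := by
  simp [Beam.A_apply, Beam.mat, Fin.sum_univ_four]

/-- Componentwise space derivative. -/
def Beam.HasDxQ (b : Beam) (v v' : b.Q) : Prop := ∀ i, b.HasDx (v i) (v' i)

theorem Beam.HasDxQ.unique {b : Beam} {v w w' : b.Q} (h : b.HasDxQ v w) (h' : b.HasDxQ v w') :
    w = w' :=
  funext fun i => (h i).unique (h' i)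

theorem Beam.HasDxQ.A {b : Beam} {v v' : b.Q} (h : b.HasDxQ v v') :
    b.HasDxQ (b.A v) (b.A v') := by
  intro i
  simp only [Beam.A_apply, Fin.sum_univ_four]
  exact ((((h 0).smul _).add ((h 1).smul _)).add ((h 2).smul _)).add ((h 3).smul _)

/-- The defects in the four boundary conditions. -/
noncomputable def Beam.bdry (b : Beam) (v : b.Q) : Fin 4 → ℝ :=
  ![b.at 0 (v 2), b.at 0 (v 3),
    b.α * b.at b.L (v 0) - b.γ * b.β * b.at b.L (v 1) + b.k₁ * b.at b.L (v 2),
    b.β * b.at b.L (v 1) - b.γ * b.β * b.at b.L (v 0) + b.k₂ * b.at b.L (v 3)]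

theorem Beam.bdry_add (b : Beam) (v w : b.Q) : b.bdry (v + w) = b.bdry v + b.bdry w := by
  ext i; fin_cases i <;> simp [Beam.bdry] <;> ring

theorem Beam.bdry_smul (b : Beam) (c : ℝ) (v : b.Q) : b.bdry (c • v) = c • b.bdry v := by
  ext i; fin_cases i <;> simp [Beam.bdry] <;> ring

theorem Beam.hasDerivAt_bdry {b : Beam} {U : ℝ → b.Q} {U' : b.Q} {t : ℝ}
    (h : HasDerivAt U U' t) : HasDerivAt (fun τ => b.bdry (U τ)) (b.bdry U') t := by
  have h' := hasDerivAt_pi.1 h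
  have k : ∀ (x : ℝ) (i : Fin 4), HasDerivAt (fun τ => b.at x (U τ i)) (b.at x (U' i)) t :=
    fun x i => (b.at x).hasFDerivAt.comp_hasDerivAt t (h' i)
  rw [hasDerivAt_pi]
  intro i
  fin_cases i
  · exact k 0 2
  · exact k 0 3
  · exact (((k b.L 0).const_mul _).sub ((k b.L 1).const_mul _)).add ((k b.L 2).const_mul _)
  · exact (((k b.L 1).const_mul _).sub ((k b.L 0).const_mul _)).add ((k b.L 3).const_mul _)

theorem Beam.bdry_time_deriv {b : Beam} {U : ℝ → b.Q} {U' : b.Q} {t : ℝ}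
    (h : HasDerivAt U U' t) (h0 : ∀ᶠ τ in 𝓝 t, b.bdry (U τ) = 0) : b.bdry U' = 0 :=
  (b.hasDerivAt_bdry h).unique ((hasDerivAt_const t 0).congr_of_eventuallyEq h0)

/-- `U` is a classical solution of the closed-loop system for `t > 0`, with space derivative
`V`. -/
structure IsSol (b : Beam) (U V : ℝ → b.Q) : Prop where
  dx : ∀ t > 0, b.HasDxQ (U t) (V t)
  dt : ∀ t > 0, HasDerivAt U (b.A (V t)) t
  bc : ∀ t > 0, b.bdry (U t) = 0

/-- The energy density. -/
noncomputable def Beam.dens (b : Beam) (v : b.Q) : b.X :=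
  (b.ρ / 2) • (v 2 * v 2) + (b.μ / 2) • (v 3 * v 3) + (b.α / 2) • (v 0 * v 0)
    - (b.γ * b.β) • (v 0 * v 1) + (b.β / 2) • (v 1 * v 1)

/-- The energy of a quadruple. -/
noncomputable def Beam.En (b : Beam) (v : b.Q) : ℝ := b.prim b.L (b.dens v)

/-- Completing the square in u₂ makes the form positive definite because α₁ > 0, and matches it with
the discrete energy. -/
theorem Beam.at_dens (b : Beam) (v : b.Q) (x : ℝ) :
    b.at x (b.dens v) = 1 / 2 * (b.ρ * b.at x (v 2) ^ 2 + b.μ * b.at x (v 3) ^ 2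
      + b.β * (b.γ * b.at x (v 0) - b.at x (v 1)) ^ 2 + b.α₁ * b.at x (v 0) ^ 2) := by
  simp only [Beam.dens, Beam.α₁, map_add, map_sub, map_smul, b.at_mul, smul_eq_mul]; ring

theorem Beam.at_dens_nonneg (b : Beam) (v : b.Q) (x : ℝ) : 0 ≤ b.at x (b.dens v) := by
  rw [b.at_dens]
  have := b.ρ_pos; have := b.μ_pos; have := b.β_pos
  have : 0 < b.α₁ := b.α₁_pos
  positivity

theorem Beam.En_nonneg (b : Beam) (v : b.Q) : 0 ≤ b.En v := b.prim_nonneg (b.at_dens_nonneg v)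

theorem Beam.En_smul (b : Beam) (c : ℝ) (v : b.Q) : b.En (c • v) = c ^ 2 * b.En v := by
  have : b.dens (c • v) = c ^ 2 • b.dens v := by
    ext x; simp [Beam.dens]; ring
  rw [Beam.En, this, map_smul, smul_eq_mul, Beam.En]

theorem Beam.continuous_En (b : Beam) : Continuous b.En := by
  unfold Beam.En Beam.dens; fun_prop

theorem IsSol.hasDerivAt_comp {b : Beam} {U V : ℝ → b.Q} (h : IsSol b U V) {t : ℝ} (ht : 0 < t) :
    HasDerivAt (fun τ => U τ 0) (V t 2) t ∧ HasDerivAt (fun τ => U τ 1) (V t 3) t ∧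
    HasDerivAt (fun τ => U τ 2)
      ((b.α / b.ρ) • V t 0 + (-(b.γ * b.β) / b.ρ) • V t 1) t ∧
    HasDerivAt (fun τ => U τ 3)
      ((-(b.γ * b.β) / b.μ) • V t 0 + (b.β / b.μ) • V t 1) t := by
  have h' := hasDerivAt_pi.1 (h.dt t ht)
  exact ⟨by simpa only [b.A_zero] using h' 0, by simpa only [b.A_one] using h' 1,
    by simpa only [b.A_two] using h' 2, by simpa only [b.A_three] using h' 3⟩

theorem IsSol.bdry_eq {b : Beam} {U V : ℝ → b.Q} (h : IsSol b U V) {t : ℝ} (ht : 0 < t) :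
    b.at 0 (U t 2) = 0 ∧ b.at 0 (U t 3) = 0 ∧
    b.α * b.at b.L (U t 0) - b.γ * b.β * b.at b.L (U t 1) = -b.k₁ * b.at b.L (U t 2) ∧
    b.β * b.at b.L (U t 1) - b.γ * b.β * b.at b.L (U t 0) = -b.k₂ * b.at b.L (U t 3) := by
  have h0 := h.bc t ht
  have e0 := congrFun h0 0
  have e1 := congrFun h0 1
  have e2 := congrFun h0 2
  have e3 := congrFun h0 3
  simp only [Beam.bdry, Pi.zero_apply, Matrix.cons_val] at e0 e1 e2 e3
  exact ⟨e0, e1, by linarith, by linarith⟩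

/-- The dissipation rate at the right end. -/
noncomputable def Beam.diss (b : Beam) (v : b.Q) : ℝ :=
  b.k₁ * b.at b.L (v 2) ^ 2 + b.k₂ * b.at b.L (v 3) ^ 2

theorem Beam.diss_nonneg (b : Beam) (v : b.Q) : 0 ≤ b.diss v := by
  have := b.k₁_pos; have := b.k₂_pos
  unfold Beam.diss; positivity

/-- The time derivative of the density is the space derivative of the flux w₁(αu₁ - γβu₂) + w₂(βu₂ -
γβu₁). The flux vanishes at 0 by clamping, and the feedback law turns it into minus the dissipation
at L. -/
theorem IsSol.hasDerivAt_En {b : Beam} {U V : ℝ → b.Q} (h : IsSol b U V) {t : ℝ} (ht : 0 < t) :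
    HasDerivAt (fun τ => b.En (U τ)) (-b.diss (U t)) t := by
  obtain ⟨d0, d1, d2, d3⟩ := h.hasDerivAt_comp ht
  obtain ⟨b0, b1, b2, b3⟩ := h.bdry_eq ht
  have x := h.dx t ht
  have hρ := b.ρ_pos.ne'
  have hμ := b.μ_pos.ne'
  have D := (((((d2.mul d2).const_smul (b.ρ / 2)).add ((d3.mul d3).const_smul (b.μ / 2))).add
    ((d0.mul d0).const_smul (b.α / 2))).sub ((d0.mul d1).const_smul (b.γ * b.β))).add
    ((d1.mul d1).const_smul (b.β / 2))
  have D' := (b.prim b.L).hasFDerivAt.comp_hasDerivAt t D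
  have q := ((x 2).mul (((x 0).smul b.α).sub ((x 1).smul (b.γ * b.β)))).add
    ((x 3).mul (((x 1).smul b.β).sub ((x 0).smul (b.γ * b.β))))
  refine D'.congr_deriv ?_
  have e := q.prim_eq
  simp only [map_add (b.at _), map_sub (b.at _), map_smul (b.at _), b.at_mul, smul_eq_mul, b0, b1,
    b2, b3] at e
  have e' : -b.diss (U t) = b.at b.L (U t 2) * (-b.k₁ * b.at b.L (U t 2))
    + b.at b.L (U t 3) * (-b.k₂ * b.at b.L (U t 3)) := by rw [Beam.diss]; ring
  rw [e']
  refine Eq.trans ?_ (e.trans (by ring))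
  congr 1
  ext y
  simp
  field_simp
  ring

theorem IsSol.antitoneOn_En {b : Beam} {U V : ℝ → b.Q} (h : IsSol b U V) :
    AntitoneOn (fun t => b.En (U t)) (Ioi 0) := by
  refine antitoneOn_of_deriv_nonpos (convex_Ioi 0)
    (fun t ht => (h.hasDerivAt_En ht).continuousAt.continuousWithinAt) ?_ ?_
  · rw [interior_Ioi]
    exact fun t ht => (h.hasDerivAt_En ht).differentiableAt.differentiableWithinAt
  · rw [interior_Ioi]
    intro t ht
    rw [(h.hasDerivAt_En ht).deriv]
    linarith [b.diss_nonneg (U t)]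

theorem IsSol.shift {b : Beam} {U V : ℝ → b.Q} (h : IsSol b U V) {s : ℝ} (hs : 0 ≤ s) :
    IsSol b (fun t => U (t + s)) (fun t => V (t + s)) where
  dx t ht := h.dx _ (by linarith [show (0 : ℝ) < t from ht])
  dt t ht := (h.dt (t + s) (by linarith [show (0 : ℝ) < t from ht])).comp_add_const t s
  bc t ht := h.bc _ (by linarith [show (0 : ℝ) < t from ht])

theorem IsSol.sub {b : Beam} {U V U' V' : ℝ → b.Q} (h : IsSol b U V) (h' : IsSol b U' V') :
    IsSol b (fun t => U t - U' t) (fun t => V t - V' t) where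
  dx t ht := fun i => (h.dx t ht i).sub (h'.dx t ht i)
  dt t ht := by rw [map_sub]; exact (h.dt t ht).sub (h'.dt t ht)
  bc t ht := by
    have : U t - U' t = U t + (-1 : ℝ) • U' t := by
      rw [neg_one_smul, sub_eq_add_neg]
    rw [this, b.bdry_add, b.bdry_smul, h.bc t ht, h'.bc t ht]; simp

/-- The energy of the time derivative does not increase. -/
theorem IsSol.En_time_deriv_le {b : Beam} {U V : ℝ → b.Q} (h : IsSol b U V) {t₀ t : ℝ}
    (h0 : 0 < t₀) (ht : t₀ ≤ t) : b.En (b.A (V t)) ≤ b.En (b.A (V t₀)) := by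
  -- By linearity U(· + s) - U is again a solution, so its energy does not increase. Dividing by s²
  -- and letting s tend to 0 avoids any second derivative in time.
  have lim : ∀ τ > 0, Tendsto (fun s : ℝ => b.En (s⁻¹ • (U (τ + s) - U τ))) (𝓝[>] 0)
      (𝓝 (b.En (b.A (V τ)))) := fun τ hτ =>
    (b.continuous_En.tendsto _).comp
      (((hasDerivAt_iff_tendsto_slope_zero.1 (h.dt τ hτ)).mono_left
        (nhdsWithin_mono _ fun x hx => ne_of_gt hx)))
  refine le_of_tendsto_of_tendsto (lim t (h0.trans_le ht)) (lim t₀ h0) ?_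
  filter_upwards [self_mem_nhdsWithin] with s hs
  rw [b.En_smul, b.En_smul]
  exact mul_le_mul_of_nonneg_left
    (((h.shift (le_of_lt hs)).sub h).antitoneOn_En (mem_Ioi.2 h0) (mem_Ioi.2 (h0.trans_le ht)) ht)
    (sq_nonneg _)

/-- Coercivity of the energy density. -/
theorem Beam.exists_coercive (b : Beam) : ∃ C > 0, ∀ p q r s : ℝ,
    p ^ 2 + q ^ 2 + r ^ 2 + s ^ 2 ≤
      C * (b.ρ * r ^ 2 + b.μ * s ^ 2 + b.β * (b.γ * p - q) ^ 2 + b.α₁ * p ^ 2) := by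
  have hρ := b.ρ_pos
  have hμ := b.μ_pos
  have hβ := b.β_pos
  have hα : 0 < b.α₁ := b.α₁_pos
  have c1 : 0 < 1 / b.ρ := by positivity
  have c2 : 0 < 1 / b.μ := by positivity
  have c3 : 0 < 2 / b.β := by positivity
  have c4 : 0 < (1 + 2 * b.γ ^ 2) / b.α₁ := by positivity
  refine ⟨1 / b.ρ + 1 / b.μ + 2 / b.β + (1 + 2 * b.γ ^ 2) / b.α₁, by positivity, ?_⟩
  intro p q r s
  set C := 1 / b.ρ + 1 / b.μ + 2 / b.β + (1 + 2 * b.γ ^ 2) / b.α₁ with hC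
  have h1 : r ^ 2 ≤ C * (b.ρ * r ^ 2) :=
    calc r ^ 2 = 1 / b.ρ * (b.ρ * r ^ 2) := by field_simp
      _ ≤ _ := by gcongr; linarith
  have h2 : s ^ 2 ≤ C * (b.μ * s ^ 2) :=
    calc s ^ 2 = 1 / b.μ * (b.μ * s ^ 2) := by field_simp
      _ ≤ _ := by gcongr; linarith
  have h3 : 2 * (b.γ * p - q) ^ 2 ≤ C * (b.β * (b.γ * p - q) ^ 2) :=
    calc 2 * (b.γ * p - q) ^ 2 = 2 / b.β * (b.β * (b.γ * p - q) ^ 2) := by field_simp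
      _ ≤ _ := by gcongr; linarith
  have h4 : (1 + 2 * b.γ ^ 2) * p ^ 2 ≤ C * (b.α₁ * p ^ 2) :=
    calc (1 + 2 * b.γ ^ 2) * p ^ 2 = (1 + 2 * b.γ ^ 2) / b.α₁ * (b.α₁ * p ^ 2) := by field_simp
      _ ≤ _ := by gcongr; linarith
  -- The gap 2(γp - q)² + (1 + 2γ²)p² - (p² + q²) equals (2γp - q)².
  nlinarith [sq_nonneg (2 * (b.γ * p) - q)]

theorem Beam.exists_sq_le_dens (b : Beam) : ∃ C > 0, ∀ (v : b.Q) (x : ℝ),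
    b.at x (v 0) ^ 2 + b.at x (v 1) ^ 2 + b.at x (v 2) ^ 2 + b.at x (v 3) ^ 2
      ≤ C * b.at x (b.dens v) := by
  obtain ⟨C, hC, h⟩ := b.exists_coercive
  refine ⟨2 * C, by positivity, fun v x => (h _ _ _ _).trans (le_of_eq ?_)⟩
  rw [b.at_dens]; ring

/-- The matrix `A` is invertible. -/
theorem Beam.exists_sq_le_A (b : Beam) : ∃ C > 0, ∀ (v : b.Q) (x : ℝ) (i : Fin 4),
    b.at x (v i) ^ 2 ≤ C * (b.at x (b.A v 0) ^ 2 + b.at x (b.A v 1) ^ 2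
      + b.at x (b.A v 2) ^ 2 + b.at x (b.A v 3) ^ 2) := by
  have hρ := b.ρ_pos
  have hμ := b.μ_pos
  have hβ := b.β_pos
  have hα : 0 < b.α₁ := b.α₁_pos
  set K := 2 * (b.ρ ^ 2 + b.γ ^ 2 * b.μ ^ 2) / b.α₁ ^ 2 with hK
  have hK0 : 0 < K := by positivity
  set M := 2 * b.μ ^ 2 / b.β ^ 2 with hM
  have hM0 : 0 < M := by positivity
  refine ⟨1 + K + (M + 2 * b.γ ^ 2 * K), by positivity, ?_⟩
  intro v x i
  have e0 : b.at x (b.A v 0) = b.at x (v 2) := by rw [b.A_zero]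
  have e1 : b.at x (b.A v 1) = b.at x (v 3) := by rw [b.A_one]
  have e2 : b.ρ * b.at x (b.A v 2) = b.α * b.at x (v 0) - b.γ * b.β * b.at x (v 1) := by
    rw [b.A_two, map_add, map_smul, map_smul, smul_eq_mul, smul_eq_mul]; field_simp; ring
  have e3 : b.μ * b.at x (b.A v 3) = b.β * b.at x (v 1) - b.γ * b.β * b.at x (v 0) := by
    rw [b.A_three, map_add, map_smul, map_smul, smul_eq_mul, smul_eq_mul]; field_simp; ring
  rw [e0, e1]
  generalize b.at x (b.A v 2) = a at *
  generalize b.at x (b.A v 3) = c at *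
  -- Adding γ times the second row to the first eliminates u₂ and leaves α₁u₁.
  have p0 : b.at x (v 0) = (b.ρ * a + b.γ * (b.μ * c)) / b.α₁ := by
    rw [e2, e3, eq_div_iff hα.ne', Beam.α₁]; ring
  have p1 : b.at x (v 1) = b.μ * c / b.β + b.γ * b.at x (v 0) := by
    rw [e3]; field_simp; ring
  have n0 : b.at x (v 0) ^ 2 ≤ K * (a ^ 2 + c ^ 2) := by
    have : K * (a ^ 2 + c ^ 2)
        = 2 * ((b.ρ ^ 2 + b.γ ^ 2 * b.μ ^ 2) * (a ^ 2 + c ^ 2)) / b.α₁ ^ 2 := by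
      rw [hK]; ring
    rw [this, p0, div_pow]
    gcongr
    nlinarith [sq_nonneg (b.ρ * a - b.γ * (b.μ * c)), sq_nonneg (b.ρ * c),
      sq_nonneg (b.γ * b.μ * a)]
  have n1 : b.at x (v 1) ^ 2 ≤ (M + 2 * b.γ ^ 2 * K) * (a ^ 2 + c ^ 2) := by
    have h1 : b.at x (v 1) ^ 2 ≤ M * c ^ 2 + 2 * b.γ ^ 2 * b.at x (v 0) ^ 2 := by
      have : M * c ^ 2 = 2 * (b.μ * c / b.β) ^ 2 := by rw [hM]; ring
      rw [this, p1]
      nlinarith [sq_nonneg (b.μ * c / b.β - b.γ * b.at x (v 0))]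
    have h2 : 2 * b.γ ^ 2 * b.at x (v 0) ^ 2 ≤ 2 * b.γ ^ 2 * (K * (a ^ 2 + c ^ 2)) := by gcongr
    nlinarith [mul_nonneg hM0.le (sq_nonneg a)]
  have hM' : 0 ≤ M + 2 * b.γ ^ 2 * K := by positivity
  generalize M + 2 * b.γ ^ 2 * K = M' at *
  have ha := sq_nonneg a
  have hc := sq_nonneg c
  have hr := sq_nonneg (b.at x (v 2))
  have hs := sq_nonneg (b.at x (v 3))
  generalize a ^ 2 = a' at *
  generalize c ^ 2 = c' at *
  have big : ∀ k, 0 ≤ k → k ≤ 1 + K + M' → ∀ y z, 0 ≤ y → 0 ≤ z → z ≤ k * y →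
      y ≤ b.at x (v 2) ^ 2 + b.at x (v 3) ^ 2 + a' + c' →
      z ≤ (1 + K + M') * (b.at x (v 2) ^ 2 + b.at x (v 3) ^ 2 + a' + c') :=
    fun k hk hk' y z hy hz hzy hy' => hzy.trans (mul_le_mul hk' hy' hy (hk.trans hk'))
  fin_cases i
  · exact big K hK0.le (by linarith) (a' + c') _ (by linarith) (sq_nonneg _) n0 (by linarith)
  · exact big M' hM' (by linarith) (a' + c') _ (by linarith) (sq_nonneg _) n1 (by linarith)
  · exact big 1 one_pos.le (by linarith) _ _ hr hr (one_mul _).ge (by linarith)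
  · exact big 1 one_pos.le (by linarith) _ _ hs hs (one_mul _).ge (by linarith)

theorem Beam.norm_le_of_at (b : Beam) {v : b.Q} {C : ℝ} (hC : 0 ≤ C)
    (h : ∀ x ∈ Icc 0 b.L, ∀ i, |b.at x (v i)| ≤ C) : ‖v‖ ≤ C := by
  rw [pi_norm_le_iff_of_nonneg hC]
  intro i
  rw [ContinuousMap.norm_le _ hC]
  intro x
  simpa [b.at_coe] using h x x.2 i

theorem Beam.abs_at_le_norm (b : Beam) (v : b.Q) (x : ℝ) (i : Fin 4) : |b.at x (v i)| ≤ ‖v‖ :=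
  (b.abs_at_le x _).trans (norm_le_pi_norm v i)

theorem Beam.exists_norm_le_A (b : Beam) : ∃ C > 0, ∀ v : b.Q, ‖v‖ ≤ C * ‖b.A v‖ := by
  obtain ⟨C, hC, h⟩ := b.exists_sq_le_A
  refine ⟨√(4 * C), by positivity, fun v => b.norm_le_of_at (by positivity) fun x _ i => ?_⟩
  have k : ∀ j, b.at x (b.A v j) ^ 2 ≤ ‖b.A v‖ ^ 2 := fun j =>
    sq_le_sq' (abs_le.1 (b.abs_at_le_norm _ x j)).1 (abs_le.1 (b.abs_at_le_norm _ x j)).2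
  refine abs_le_of_sq_le_sq ?_ (by positivity)
  rw [mul_pow, Real.sq_sqrt (by positivity)]
  refine (h v x i).trans ?_
  have := mul_le_mul_of_nonneg_left (add_le_add (add_le_add (add_le_add (k 0) (k 1)) (k 2)) (k 3))
    hC.le
  linarith

/-- A classical solution is bounded. -/
theorem IsSol.exists_norm_le {b : Beam} {U V : ℝ → b.Q} (h : IsSol b U V) :
    ∃ C, ∀ t ≥ 1, ‖U t‖ ≤ C := by
  obtain ⟨C, hC, hd⟩ := b.exists_sq_le_dens
  obtain ⟨K, hK, hA⟩ := b.exists_sq_le_A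
  have hL := b.L_pos
  -- The energy of U controls U in L², and the energy of U_t = A U_x controls U_x in L² since A is
  -- invertible; the Sobolev inequality concludes. The reference time is 1 because `IsSol` says
  -- nothing at t = 0.
  set E₀ := b.En (U 1)
  set E₁ := b.En (b.A (V 1))
  have hE₀ : 0 ≤ E₀ := b.En_nonneg _
  have hE₁ : 0 ≤ E₁ := b.En_nonneg _
  set S := ((1 + b.L) * (C * E₀) + b.L * (K * C * E₁)) / b.L with hS
  have hS0 : 0 ≤ S := by positivity
  refine ⟨√S, fun t ht => b.norm_le_of_at (Real.sqrt_nonneg _) fun x hx i => ?_⟩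
  have ht0 : 0 < t := one_pos.trans_le ht
  refine Real.abs_le_sqrt ?_
  rw [hS, le_div_iff₀ hL, mul_comm]
  refine ((h.dx t ht0 i).sq_le hx).trans ?_
  have i1 : b.prim b.L (U t i * U t i) ≤ C * E₀ := by
    have : b.prim b.L (U t i * U t i) ≤ b.prim b.L (C • b.dens (U t)) := by
      refine b.prim_mono fun y => ?_
      rw [b.at_mul, map_smul, smul_eq_mul, ← sq]
      refine le_trans ?_ (hd (U t) y)
      fin_cases i <;> simp <;> nlinarith [sq_nonneg (b.at y (U t 0)), sq_nonneg (b.at y (U t 1)),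
        sq_nonneg (b.at y (U t 2)), sq_nonneg (b.at y (U t 3))]
    rw [map_smul, smul_eq_mul] at this
    exact this.trans (mul_le_mul_of_nonneg_left
      (h.antitoneOn_En (mem_Ioi.2 one_pos) (mem_Ioi.2 ht0) ht) hC.le)
  have i2 : b.prim b.L (V t i * V t i) ≤ K * C * E₁ := by
    have : b.prim b.L (V t i * V t i) ≤ b.prim b.L ((K * C) • b.dens (b.A (V t))) := by
      refine b.prim_mono fun y => ?_
      rw [b.at_mul, map_smul, smul_eq_mul, ← sq, mul_assoc]
      exact (hA (V t) y i).trans (mul_le_mul_of_nonneg_left (hd _ y) hK.le)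
    rw [map_smul, smul_eq_mul] at this
    exact this.trans (mul_le_mul_of_nonneg_left
      (h.En_time_deriv_le one_pos ht) (by positivity))
  gcongr

/-! ### Decay of the energy -/

/-- The multiplier functional `∫₀ᴸ x (ρ w₁ u₁ + μ w₂ u₂) dx`. -/
noncomputable def Beam.mult (b : Beam) (v : b.Q) : ℝ :=
  b.prim b.L (b.idX * (b.ρ • (v 2 * v 0) + b.μ • (v 3 * v 1)))

/-- By the equations, ρw₁u₁ + μw₂u₂ has as time derivative the space derivative of the energy
density. Integration by parts against x leaves the density at L and minus the energy. -/
theorem IsSol.hasDerivAt_mult {b : Beam} {U V : ℝ → b.Q} (h : IsSol b U V) {t : ℝ} (ht : 0 < t) :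
    HasDerivAt (fun τ => b.mult (U τ)) (b.L * b.at b.L (b.dens (U t)) - b.En (U t)) t := by
  obtain ⟨d0, d1, d2, d3⟩ := h.hasDerivAt_comp ht
  have x := h.dx t ht
  have hρ := b.ρ_pos.ne'
  have hμ := b.μ_pos.ne'
  have D := (((d2.mul d0).const_smul b.ρ).add ((d3.mul d1).const_smul b.μ)).const_mul b.idX
  have D' := (b.prim b.L).hasFDerivAt.comp_hasDerivAt t D
  have q : b.HasDx (b.dens (U t)) _ :=
    ((((((x 2).mul (x 2)).smul (b.ρ / 2)).add (((x 3).mul (x 3)).smul (b.μ / 2))).add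
    (((x 0).mul (x 0)).smul (b.α / 2))).sub (((x 0).mul (x 1)).smul (b.γ * b.β))).add
    (((x 1).mul (x 1)).smul (b.β / 2))
  have e := (b.hasDx_idX.mul q).prim_eq
  rw [b.at_mul, b.at_mul, b.at_idX (left_mem_Icc.2 b.L_pos.le),
    b.at_idX (right_mem_Icc.2 b.L_pos.le), zero_mul, sub_zero, one_mul, map_add] at e
  refine D'.congr_deriv ?_
  rw [← e, Beam.En, add_sub_cancel_left]
  refine congrArg (b.prim b.L) (congrArg (b.idX * ·) ?_)
  ext y
  simp
  field_simp
  ring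

theorem Beam.exists_abs_mult_le (b : Beam) : ∃ C > 0, ∀ v : b.Q, |b.mult v| ≤ C * b.En v := by
  obtain ⟨C, hC, hd⟩ := b.exists_sq_le_dens
  have hL := b.L_pos
  have hρ := b.ρ_pos
  have hμ := b.μ_pos
  refine ⟨b.L * (b.ρ + b.μ) * C, by positivity, fun v => ?_⟩
  have key : ∀ x, |b.at x (b.idX * (b.ρ • (v 2 * v 0) + b.μ • (v 3 * v 1)))|
      ≤ b.L * (b.ρ + b.μ) * C * b.at x (b.dens v) := by
    intro x
    have hx : |b.at x b.idX| ≤ b.L := by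
      have m := (projIcc 0 b.L hL.le x).2
      exact abs_le.2 ⟨(neg_nonpos.2 hL.le).trans m.1, m.2⟩
    have hS := hd v x
    rw [b.at_mul, map_add, map_smul, map_smul, b.at_mul, b.at_mul, smul_eq_mul, smul_eq_mul,
      abs_mul]
    generalize b.at x (v 0) = p at *
    generalize b.at x (v 1) = q at *
    generalize b.at x (v 2) = r at *
    generalize b.at x (v 3) = s at *
    have h1 : |b.ρ * (r * p) + b.μ * (s * q)| ≤ (b.ρ + b.μ) * (p ^ 2 + q ^ 2 + r ^ 2 + s ^ 2) := by
      have a1 : |r * p| ≤ p ^ 2 + q ^ 2 + r ^ 2 + s ^ 2 := by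
        rw [abs_le]; constructor <;>
          nlinarith [sq_nonneg (r + p), sq_nonneg (r - p), sq_nonneg q, sq_nonneg s]
      have a2 : |s * q| ≤ p ^ 2 + q ^ 2 + r ^ 2 + s ^ 2 := by
        rw [abs_le]; constructor <;>
          nlinarith [sq_nonneg (s + q), sq_nonneg (s - q), sq_nonneg p, sq_nonneg r]
      calc |b.ρ * (r * p) + b.μ * (s * q)| ≤ |b.ρ * (r * p)| + |b.μ * (s * q)| := abs_add_le _ _
        _ = b.ρ * |r * p| + b.μ * |s * q| := by
          rw [abs_mul b.ρ, abs_mul b.μ, abs_of_pos hρ, abs_of_pos hμ]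
        _ ≤ _ := by rw [add_mul]; gcongr
    calc |b.at x b.idX| * |b.ρ * (r * p) + b.μ * (s * q)|
        ≤ b.L * ((b.ρ + b.μ) * (C * b.at x (b.dens v))) := by
          refine mul_le_mul hx (h1.trans ?_) (abs_nonneg _) hL.le
          gcongr
      _ = _ := by ring
  rw [abs_le]
  have k : b.L * (b.ρ + b.μ) * C * b.En v
      = b.prim b.L ((b.L * (b.ρ + b.μ) * C) • b.dens v) := by
    rw [map_smul, smul_eq_mul, Beam.En]
  rw [k, ← map_neg]
  constructor
  · refine b.prim_mono fun x => ?_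
    rw [map_neg, map_smul, smul_eq_mul]
    exact (abs_le.1 (key x)).1
  · refine b.prim_mono fun x => ?_
    rw [map_smul, smul_eq_mul]
    exact (abs_le.1 (key x)).2

theorem Beam.continuous_mult (b : Beam) : Continuous b.mult := by
  unfold Beam.mult; fun_prop

/-- The boundary damping controls the boundary trace. -/
theorem Beam.exists_dens_le_diss (b : Beam) : ∃ C > 0, ∀ v : b.Q,
    b.α * b.at b.L (v 0) - b.γ * b.β * b.at b.L (v 1) = -b.k₁ * b.at b.L (v 2) →
    b.β * b.at b.L (v 1) - b.γ * b.β * b.at b.L (v 0) = -b.k₂ * b.at b.L (v 3) →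
    b.L * b.at b.L (b.dens v) ≤ C * b.diss v := by
  have hL := b.L_pos
  have hρ := b.ρ_pos
  have hμ := b.μ_pos
  have hβ := b.β_pos
  have hk₁ := b.k₁_pos
  have hk₂ := b.k₂_pos
  have hα : 0 < b.α₁ := b.α₁_pos
  set c₁ := b.ρ + 2 * b.k₁ ^ 2 / b.α₁ with hc₁
  set c₂ := b.μ + b.k₂ ^ 2 / b.β + 2 * b.γ ^ 2 * b.k₂ ^ 2 / b.α₁ with hc₂
  have h₁ : 0 < c₁ := by positivity
  have h₂ : 0 < c₂ := by positivity
  refine ⟨b.L * (c₁ / b.k₁ + c₂ / b.k₂), by positivity, fun v e1 e2 => ?_⟩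
  rw [b.at_dens, Beam.diss, mul_assoc]
  refine mul_le_mul_of_nonneg_left ?_ hL.le
  generalize b.at b.L (v 0) = p at *
  generalize b.at b.L (v 1) = q at *
  generalize b.at b.L (v 2) = r at *
  generalize b.at b.L (v 3) = s at *
  have f1 : b.β * (b.γ * p - q) ^ 2 = b.k₂ ^ 2 / b.β * s ^ 2 := by
    have : b.γ * p - q = b.k₂ * s / b.β := by
      rw [eq_div_iff hβ.ne']; linarith
    rw [this]; field_simp
  have f2 : b.α₁ * p ^ 2 ≤ 2 * b.k₁ ^ 2 / b.α₁ * r ^ 2 + 2 * b.γ ^ 2 * b.k₂ ^ 2 / b.α₁ * s ^ 2 := by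
    have : p = -(b.k₁ * r + b.γ * b.k₂ * s) / b.α₁ := by
      rw [eq_div_iff hα.ne', Beam.α₁]; linear_combination e1 + b.γ * e2
    have e : b.α₁ * p ^ 2 = (b.k₁ * r + b.γ * b.k₂ * s) ^ 2 / b.α₁ := by
      rw [this]; field_simp
    have e' : 2 * b.k₁ ^ 2 / b.α₁ * r ^ 2 + 2 * b.γ ^ 2 * b.k₂ ^ 2 / b.α₁ * s ^ 2
      = (2 * (b.k₁ * r) ^ 2 + 2 * (b.γ * b.k₂ * s) ^ 2) / b.α₁ := by ring
    rw [e, e']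
    gcongr
    nlinarith [sq_nonneg (b.k₁ * r - b.γ * b.k₂ * s)]
  have g1 : c₁ * r ^ 2 = c₁ / b.k₁ * (b.k₁ * r ^ 2) := by field_simp
  have g2 : c₂ * s ^ 2 = c₂ / b.k₂ * (b.k₂ * s ^ 2) := by field_simp
  have m1 : 0 ≤ c₁ / b.k₁ * (b.k₂ * s ^ 2) := by positivity
  have m2 : 0 ≤ c₂ / b.k₂ * (b.k₁ * r ^ 2) := by positivity
  have m3 : 0 ≤ c₁ * r ^ 2 := by positivity
  have m4 : 0 ≤ c₂ * s ^ 2 := by positivity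
  have tot : b.ρ * r ^ 2 + b.μ * s ^ 2 + b.β * (b.γ * p - q) ^ 2 + b.α₁ * p ^ 2
      ≤ c₁ * r ^ 2 + c₂ * s ^ 2 := by
    rw [f1, hc₁, hc₂]; linarith
  nlinarith

/-- In the Lyapunov function tE + mult + (C₁ + C₂)E the term E from differentiating tE cancels the
-E of the multiplier. The boundary term that remains is absorbed by C₂ times the dissipation, while
C₁E dominates the multiplier itself. -/
theorem IsSol.exists_decay {b : Beam} {U V : ℝ → b.Q} (h : IsSol b U V)
    (hc : ContinuousOn U (Ici 0)) : ∃ C > 0, ∀ t ≥ 0, t * b.En (U t) ≤ C := by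
  obtain ⟨C₁, hC₁, h1⟩ := b.exists_abs_mult_le
  obtain ⟨C₂, hC₂, h2⟩ := b.exists_dens_le_diss
  have cE : ContinuousOn (fun t => b.En (U t)) (Ici 0) := b.continuous_En.comp_continuousOn hc
  have anti : AntitoneOn (fun t => t * b.En (U t) + b.mult (U t) + (C₁ + C₂) * b.En (U t))
      (Ici 0) := by
    refine antitoneOn_of_hasDerivWithinAt_nonpos (convex_Ici 0)
      (f' := fun t => 1 * b.En (U t) + t * (-b.diss (U t))
        + (b.L * b.at b.L (b.dens (U t)) - b.En (U t)) + (C₁ + C₂) * (-b.diss (U t))) ?_ ?_ ?_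
    · exact ((continuousOn_id.mul cE).add (b.continuous_mult.comp_continuousOn hc)).add
        (continuousOn_const.mul cE)
    · intro t ht
      rw [interior_Ici] at ht
      exact ((((hasDerivAt_id t).mul (h.hasDerivAt_En ht)).add (h.hasDerivAt_mult ht)).add
        ((h.hasDerivAt_En ht).const_mul _)).hasDerivWithinAt
    · intro t ht
      rw [interior_Ici] at ht
      have ht' : 0 < t := ht
      obtain ⟨-, -, b2, b3⟩ := h.bdry_eq ht
      have := h2 _ b2 b3
      have d := b.diss_nonneg (U t)
      nlinarith [mul_nonneg ht'.le d, mul_nonneg hC₁.le d]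
  have E0 := b.En_nonneg (U 0)
  refine ⟨(2 * C₁ + C₂) * b.En (U 0) + 1, by positivity, fun t ht => ?_⟩
  have a := anti self_mem_Ici (mem_Ici.2 ht) ht
  simp only [zero_mul, zero_add] at a
  have p1 := abs_le.1 (h1 (U 0))
  have p2 := abs_le.1 (h1 (U t))
  have Et := b.En_nonneg (U t)
  nlinarith [mul_nonneg hC₂.le Et, p1.2, p2.1]

/-! ### The discrete energy -/

theorem Beam.h_pos (b : Beam) (N : ℕ) : 0 < b.h N :=
  div_pos b.L_pos (by positivity)

theorem Beam.h_mul (b : Beam) (N : ℕ) : b.h N * (N + 1) = b.L :=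
  div_mul_cancel₀ _ (by positivity)

theorem GridData.energy_nonneg (b : Beam) {N : ℕ} (g : GridData N) : 0 ≤ g.energy b := by
  have := b.ρ_pos; have := b.μ_pos; have := b.β_pos; have := b.h_pos N
  have : 0 < b.α₁ := b.α₁_pos
  unfold GridData.energy
  positivity

theorem sum_succ_sub_castSucc {n : ℕ} (F : Fin (n + 1) → ℝ) :
    ∑ j : Fin n, (F j.succ - F j.castSucc) = F (Fin.last n) - F 0 := by
  have h := (Fin.sum_univ_succ F).symm.trans (Fin.sum_univ_castSucc F)
  rw [Finset.sum_sub_distrib]; linarith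

/-- The discrete product rule. -/
theorem Beam.sum_avg_mul_δ (b : Beam) {N : ℕ} (U V : Fin (N + 2) → ℝ) :
    b.h N * ∑ j : Fin (N + 1), (avg U j * b.δ V j + avg V j * b.δ U j) =
      U (Fin.last _) * V (Fin.last _) - U 0 * V 0 := by
  rw [← sum_succ_sub_castSucc (fun i => U i * V i), Finset.mul_sum]
  refine Finset.sum_congr rfl fun j _ => ?_
  have := (b.h_pos N).ne'
  simp only [avg, Beam.δ]
  field_simp
  ring

/-- The dissipation rate of the discrete system. -/
noncomputable def GridData.diss (b : Beam) {N : ℕ} (g : GridData N) : ℝ :=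
  b.k₁ * g.w₁ (Fin.last _) ^ 2 + b.k₂ * g.w₂ (Fin.last _) ^ 2

theorem GridData.diss_nonneg (b : Beam) {N : ℕ} (g : GridData N) : 0 ≤ g.diss b := by
  have := b.k₁_pos; have := b.k₂_pos
  unfold GridData.diss; positivity

/-- The power of the right-hand sides. -/
noncomputable def Residual.power (b : Beam) {N : ℕ} (R : Residual N) (g : GridData N) (t : ℝ) : ℝ :=
  b.h N * ∑ j : Fin (N + 1), (R.s₁ t j * avg g.w₁ j + R.s₂ t j * avg g.w₂ j
    + R.r₁ t j * (b.α * avg g.u₁ j - b.γ * b.β * avg g.u₂ j)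
    + R.r₂ t j * (b.β * avg g.u₂ j - b.γ * b.β * avg g.u₁ j))

theorem differentiableAt_avg {N : ℕ} {U : ℝ → Fin (N + 2) → ℝ} {t : ℝ}
    (h : ∀ j, DifferentiableAt ℝ (fun τ => U τ j) t) (j : Fin (N + 1)) :
    DifferentiableAt ℝ (fun τ => avg (U τ) j) t :=
  ((h _).add (h _)).div_const 2

/-- The scheme keeps the continuous energy identity exactly: averages against difference quotients
telescope to boundary terms, without a numerical remainder. Only the right-hand sides add a power.
-/
theorem SolvesORFD.hasDerivAt_energy {b : Beam} {N : ℕ} {R : Residual N} {g₀ : GridData N}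
    {g : ℝ → GridData N} (hg : SolvesORFD b R g₀ g) {t : ℝ} (ht : 0 < t) :
    HasDerivAt (fun τ => (g τ).energy b) (-(g t).diss b + R.power b (g t) t) t := by
  have dd := hg.diff
  have du₁ := fun j => (differentiableAt_avg (fun j => (dd j t ht).1) j).hasDerivAt
  have du₂ := fun j => (differentiableAt_avg (fun j => (dd j t ht).2.1) j).hasDerivAt
  have dw₁ := fun j => (differentiableAt_avg (fun j => (dd j t ht).2.2.1) j).hasDerivAt
  have dw₂ := fun j => (differentiableAt_avg (fun j => (dd j t ht).2.2.2) j).hasDerivAt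
  have D := (HasDerivAt.fun_sum (u := Finset.univ) fun (j : Fin (N + 1)) _ =>
    (((((dw₁ j).pow 2).const_mul b.ρ).add (((dw₂ j).pow 2).const_mul b.μ)).add
    (((((du₁ j).const_mul b.γ).sub (du₂ j)).pow 2).const_mul b.β)).add
    (((du₁ j).pow 2).const_mul b.α₁)).const_mul (b.h N / 2)
  have hE : (fun τ => (g τ).energy b) = fun τ => b.h N / 2 * ∑ j : Fin (N + 1),
    (b.ρ * avg (g τ).w₁ j ^ 2 + b.μ * avg (g τ).w₂ j ^ 2
      + b.β * (b.γ * avg (g τ).u₁ j - avg (g τ).u₂ j) ^ 2 + b.α₁ * avg (g τ).u₁ j ^ 2) := by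
    funext τ; simp only [GridData.energy, sq_abs]
  rw [hE]
  refine D.congr_deriv ?_
  have f1 := b.sum_avg_mul_δ (g t).u₁ (g t).w₁
  have f2 := b.sum_avg_mul_δ (g t).u₂ (g t).w₂
  have f3 := b.sum_avg_mul_δ (g t).u₁ (g t).w₂
  have f4 := b.sum_avg_mul_δ (g t).u₂ (g t).w₁
  rw [hg.clamped₁ t ht, mul_zero, sub_zero] at f1 f4
  rw [hg.clamped₂ t ht, mul_zero, sub_zero] at f2 f3
  have hd : -(g t).diss b
      = b.α * ((g t).u₁ (Fin.last _) * (g t).w₁ (Fin.last _))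
        + b.β * ((g t).u₂ (Fin.last _) * (g t).w₂ (Fin.last _))
        - b.γ * b.β * ((g t).u₁ (Fin.last _) * (g t).w₂ (Fin.last _))
        - b.γ * b.β * ((g t).u₂ (Fin.last _) * (g t).w₁ (Fin.last _)) := by
    rw [GridData.diss]
    linear_combination -(g t).w₁ (Fin.last _) * hg.feedback₁ t ht
      - (g t).w₂ (Fin.last _) * hg.feedback₂ t ht
  rw [hd, ← f1, ← f2, ← f3, ← f4, Residual.power]
  simp only [Finset.mul_sum]
  rw [← Finset.sum_add_distrib, ← Finset.sum_sub_distrib, ← Finset.sum_sub_distrib,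
    ← Finset.sum_add_distrib]
  refine Finset.sum_congr rfl fun j _ => ?_
  rw [← hg.compat₁ t ht j, ← hg.compat₂ t ht j, ← hg.momentum₁ t ht j, ← hg.momentum₂ t ht j,
    Beam.α₁]
  simp
  ring

theorem SolvesORFD.continuousOn_energy {b : Beam} {N : ℕ} {R : Residual N} {g₀ : GridData N}
    {g : ℝ → GridData N} (hg : SolvesORFD b R g₀ g) :
    ContinuousOn (fun t => (g t).energy b) (Ici 0) := by
  have c1 := fun j => (hg.cont j).1
  have c2 := fun j => (hg.cont j).2.1
  have c3 := fun j => (hg.cont j).2.2.1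
  have c4 := fun j => (hg.cont j).2.2.2
  unfold GridData.energy avg
  fun_prop

theorem GridData.zero_energy (b : Beam) (N : ℕ) : (GridData.zero N).energy b = 0 := by
  simp [GridData.energy, GridData.zero, avg]

/-- Bound of the power of the right-hand sides in terms of the energy. -/
theorem Beam.exists_power_le (b : Beam) : ∃ C > 0, ∀ (N : ℕ) (R : Residual N) (g : GridData N)
    (t K : ℝ), (∀ j, |R.s₁ t j| ≤ K ∧ |R.s₂ t j| ≤ K ∧ |R.r₁ t j| ≤ K ∧ |R.r₂ t j| ≤ K) →
      |R.power b g t| ≤ C * K * √(g.energy b) := by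
  obtain ⟨C, hC, hc⟩ := b.exists_coercive
  have hα := b.α_pos
  have hβ := b.β_pos
  have hγ := b.γ_pos
  have hL := b.L_pos
  set M := 1 + b.α + b.γ * b.β + b.β with hM
  have hM0 : 0 < M := by positivity
  -- In 8CL, the factor 4 comes from squaring a sum of four terms, 2 from the h/2 in the energy, and
  -- L = h(N + 1) from Cauchy–Schwarz over the cells.
  refine ⟨M * √(8 * C * b.L), by positivity, fun N R g t K hR => ?_⟩
  have hK : 0 ≤ K := (abs_nonneg _).trans (hR 0).1
  have hh := b.h_pos N
  let T : Fin (N + 1) → ℝ := fun j =>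
    |avg g.w₁ j| + |avg g.w₂ j| + |avg g.u₁ j| + |avg g.u₂ j|
  have hT : ∀ j, |R.s₁ t j * avg g.w₁ j + R.s₂ t j * avg g.w₂ j
    + R.r₁ t j * (b.α * avg g.u₁ j - b.γ * b.β * avg g.u₂ j)
    + R.r₂ t j * (b.β * avg g.u₂ j - b.γ * b.β * avg g.u₁ j)| ≤ M * K * T j := by
    intro j
    obtain ⟨h1, h2, h3, h4⟩ := hR j
    have a1 : |b.α * avg g.u₁ j - b.γ * b.β * avg g.u₂ j|
        ≤ b.α * |avg g.u₁ j| + b.γ * b.β * |avg g.u₂ j| := by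
      refine (abs_sub _ _).trans (le_of_eq ?_)
      rw [abs_mul b.α, abs_mul (b.γ * b.β), abs_of_pos hα, abs_of_pos (mul_pos hγ hβ)]
    have a2 : |b.β * avg g.u₂ j - b.γ * b.β * avg g.u₁ j|
        ≤ b.β * |avg g.u₂ j| + b.γ * b.β * |avg g.u₁ j| := by
      refine (abs_sub _ _).trans (le_of_eq ?_)
      rw [abs_mul b.β, abs_mul (b.γ * b.β), abs_of_pos hβ, abs_of_pos (mul_pos hγ hβ)]
    refine (abs_add_le _ _).trans ((add_le_add (abs_add_le _ _) le_rfl).trans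
      ((add_le_add (add_le_add (abs_add_le _ _) le_rfl) le_rfl).trans ?_))
    rw [abs_mul, abs_mul, abs_mul, abs_mul]
    have m1 := mul_le_mul h1 le_rfl (abs_nonneg (avg g.w₁ j)) hK
    have m2 := mul_le_mul h2 le_rfl (abs_nonneg (avg g.w₂ j)) hK
    have m3 := mul_le_mul h3 a1 (abs_nonneg _) hK
    have m4 := mul_le_mul h4 a2 (abs_nonneg _) hK
    have e : M * K * T j = K * |avg g.w₁ j| + K * |avg g.w₂ j|
        + K * (b.α * |avg g.u₁ j| + b.γ * b.β * |avg g.u₂ j|)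
        + K * (b.β * |avg g.u₂ j| + b.γ * b.β * |avg g.u₁ j|)
        + K * ((b.α + b.γ * b.β + b.β) * (|avg g.w₁ j| + |avg g.w₂ j|)
          + (1 + b.β) * |avg g.u₁ j| + (1 + b.α) * |avg g.u₂ j|) := by
      simp only [T, hM]; ring
    rw [e]
    have : 0 ≤ K * ((b.α + b.γ * b.β + b.β) * (|avg g.w₁ j| + |avg g.w₂ j|)
          + (1 + b.β) * |avg g.u₁ j| + (1 + b.α) * |avg g.u₂ j|) := by positivity
    linarith
  have hT2 : ∀ j, T j ^ 2 ≤ 4 * C * (b.ρ * |avg g.w₁ j| ^ 2 + b.μ * |avg g.w₂ j| ^ 2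
      + b.β * |b.γ * avg g.u₁ j - avg g.u₂ j| ^ 2 + b.α₁ * |avg g.u₁ j| ^ 2) := by
    intro j
    have := hc (avg g.u₁ j) (avg g.u₂ j) (avg g.w₁ j) (avg g.w₂ j)
    simp only [sq_abs]
    refine le_trans ?_ ((mul_le_mul_of_nonneg_left this (by norm_num : (0 : ℝ) ≤ 4)).trans
      (by rw [mul_assoc]))
    simp only [T]
    rw [← sq_abs (avg g.u₁ j), ← sq_abs (avg g.u₂ j), ← sq_abs (avg g.w₁ j),
      ← sq_abs (avg g.w₂ j)]
    generalize |avg g.u₁ j| = p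
    generalize |avg g.u₂ j| = q
    generalize |avg g.w₁ j| = r
    generalize |avg g.w₂ j| = s
    nlinarith [sq_nonneg (p - q), sq_nonneg (p - r), sq_nonneg (p - s), sq_nonneg (q - r),
      sq_nonneg (q - s), sq_nonneg (r - s)]
  have hsum : b.h N * ∑ j, T j ≤ √(8 * C * b.L) * √(g.energy b) := by
    rw [← Real.sqrt_mul (by positivity)]
    refine Real.le_sqrt_of_sq_le ?_
    have cs := sq_sum_le_card_mul_sum_sq (s := Finset.univ) (f := T)
    rw [Finset.card_univ, Fintype.card_fin] at cs
    have s2 : ∑ j, T j ^ 2 ≤ ∑ j, 4 * C * (b.ρ * |avg g.w₁ j| ^ 2 + b.μ * |avg g.w₂ j| ^ 2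
      + b.β * |b.γ * avg g.u₁ j - avg g.u₂ j| ^ 2 + b.α₁ * |avg g.u₁ j| ^ 2) :=
      Finset.sum_le_sum fun j _ => hT2 j
    rw [← Finset.mul_sum] at s2
    have e : 8 * C * b.L * g.energy b = b.h N * b.L * (4 * C * ∑ j : Fin (N + 1),
      (b.ρ * |avg g.w₁ j| ^ 2 + b.μ * |avg g.w₂ j| ^ 2
      + b.β * |b.γ * avg g.u₁ j - avg g.u₂ j| ^ 2 + b.α₁ * |avg g.u₁ j| ^ 2)) := by
      rw [GridData.energy]; ring
    rw [e]
    calc (b.h N * ∑ j, T j) ^ 2 = b.h N ^ 2 * (∑ j, T j) ^ 2 := by ring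
      _ ≤ b.h N ^ 2 * (((N + 1 : ℕ) : ℝ) * ∑ j, T j ^ 2) := by gcongr
      _ = b.h N * (b.h N * (N + 1)) * ∑ j, T j ^ 2 := by push_cast; ring
      _ = b.h N * b.L * ∑ j, T j ^ 2 := by rw [b.h_mul]
      _ ≤ _ := by gcongr
  calc |R.power b g t| ≤ b.h N * ∑ j, M * K * T j := by
        rw [Residual.power, abs_mul, abs_of_pos hh]
        exact mul_le_mul_of_nonneg_left ((Finset.abs_sum_le_sum_abs _ _).trans
          (Finset.sum_le_sum fun j _ => hT j)) hh.le
    _ = M * K * (b.h N * ∑ j, T j) := by rw [← Finset.mul_sum]; ring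
    _ ≤ M * K * (√(8 * C * b.L) * √(g.energy b)) := by gcongr
    _ = _ := by ring

/-! ### Taylor remainders of the average and the difference quotient -/

/-- Taylor remainder of a symmetric second difference. -/
theorem exists_second_difference {φ φ₁ φ₂ : ℝ → ℝ} {m H : ℝ} (hH : 0 < H) (c : Continuous φ)
    (h1 : ∀ x ∈ Ioo (m - H) (m + H), HasDerivAt φ (φ₁ x) x)
    (h2 : ∀ x ∈ Ioo (m - H) (m + H), HasDerivAt φ₁ (φ₂ x) x) :
    ∃ ξ ∈ Ioo (m - H) (m + H), φ (m + H) + φ (m - H) - 2 * φ m = H ^ 2 * φ₂ ξ := by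
  -- Cauchy's mean value theorem against s² reduces the claim to a difference quotient of φ₁ on [m -
  -- s, m + s].
  obtain ⟨s, hs, e⟩ := exists_ratio_hasDerivAt_eq_ratio_slope
    (fun s => φ (m + s) + φ (m - s) - 2 * φ m) (fun s => φ₁ (m + s) - φ₁ (m - s)) hH
    (by fun_prop) (fun s hs => by
      have a := (h1 (m + s) ⟨by linarith [hs.1], by linarith [hs.2]⟩).comp_const_add m s
      have b := (h1 (m - s) ⟨by linarith [hs.2], by linarith [hs.1]⟩).comp_const_sub m s
      simpa [sub_eq_add_neg] using (a.add b).sub_const (2 * φ m))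
    (fun s => s ^ 2) (fun s => 2 * s) (by fun_prop) (fun s _ => by simpa using hasDerivAt_pow 2 s)
  have hs0 := hs.1
  have sub : Icc (m - s) (m + s) ⊆ Ioo (m - H) (m + H) := fun y hy =>
    ⟨by linarith [hy.1, hs.2], by linarith [hy.2, hs.2]⟩
  obtain ⟨ξ, hξ, e'⟩ := exists_hasDerivAt_eq_slope φ₁ φ₂ (by linarith : m - s < m + s)
    (fun y hy => (h2 y (sub hy)).continuousAt.continuousWithinAt)
    (fun y hy => h2 y (sub (Ioo_subset_Icc_self hy)))
  refine ⟨ξ, sub (Ioo_subset_Icc_self hξ), ?_⟩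
  rw [eq_div_iff (by linarith)] at e'
  have : 2 * s * (φ (m + H) + φ (m - H) - 2 * φ m) = 2 * s * (H ^ 2 * φ₂ ξ) := by
    simp only [add_zero, sub_zero] at e
    linear_combination -e - H ^ 2 * e'
  exact mul_left_cancel₀ (by positivity) this

/-- Taylor remainder of a symmetric first difference. -/
theorem exists_first_difference {φ φ₁ φ₂ φ₃ : ℝ → ℝ} {m H : ℝ} (hH : 0 < H) (c : Continuous φ)
    (c1 : Continuous φ₁)
    (h1 : ∀ x ∈ Ioo (m - H) (m + H), HasDerivAt φ (φ₁ x) x)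
    (h2 : ∀ x ∈ Ioo (m - H) (m + H), HasDerivAt φ₁ (φ₂ x) x)
    (h3 : ∀ x ∈ Ioo (m - H) (m + H), HasDerivAt φ₂ (φ₃ x) x) :
    ∃ ξ ∈ Ioo (m - H) (m + H), φ (m + H) - φ (m - H) - 2 * H * φ₁ m = H ^ 3 / 3 * φ₃ ξ := by
  -- Cauchy's mean value theorem against s³ leaves a second difference of φ₁, to which the previous
  -- lemma applies.
  obtain ⟨s, hs, e⟩ := exists_ratio_hasDerivAt_eq_ratio_slope
    (fun s => φ (m + s) - φ (m - s) - 2 * φ₁ m * s)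
    (fun s => φ₁ (m + s) + φ₁ (m - s) - 2 * φ₁ m) hH
    (by fun_prop) (fun s hs => by
      have a := (h1 (m + s) ⟨by linarith [hs.1], by linarith [hs.2]⟩).comp_const_add m s
      have b := (h1 (m - s) ⟨by linarith [hs.2], by linarith [hs.1]⟩).comp_const_sub m s
      exact ((a.sub b).sub ((hasDerivAt_id s).const_mul (2 * φ₁ m))).congr_deriv (by simp))
    (fun s => s ^ 3) (fun s => 3 * s ^ 2) (by fun_prop)
    (fun s _ => by simpa using hasDerivAt_pow 3 s)
  have hs0 := hs.1
  have sub : Ioo (m - s) (m + s) ⊆ Ioo (m - H) (m + H) := fun y hy =>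
    ⟨by linarith [hy.1, hs.2], by linarith [hy.2, hs.2]⟩
  obtain ⟨ξ, hξ, e'⟩ := exists_second_difference hs0 c1 (fun y hy => h2 y (sub hy))
    (fun y hy => h3 y (sub hy))
  refine ⟨ξ, sub hξ, ?_⟩
  have : 3 * s ^ 2 * (φ (m + H) - φ (m - H) - 2 * H * φ₁ m)
      = 3 * s ^ 2 * (H ^ 3 / 3 * φ₃ ξ) := by
    simp only [add_zero, sub_zero] at e
    linear_combination -e + H ^ 3 * e'
  exact mul_left_cancel₀ (by positivity) this

/-- The midpoint `x_{j+1/2}`. -/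
noncomputable def Beam.mid (b : Beam) (N : ℕ) (j : Fin (N + 1)) : ℝ :=
  b.node N j.castSucc + b.h N / 2

theorem Beam.node_castSucc (b : Beam) (N : ℕ) (j : Fin (N + 1)) :
    b.node N j.castSucc = b.mid N j - b.h N / 2 := by
  rw [Beam.mid]; ring

theorem Beam.node_succ (b : Beam) (N : ℕ) (j : Fin (N + 1)) :
    b.node N j.succ = b.mid N j + b.h N / 2 := by
  simp only [Beam.mid, Beam.node, Fin.val_succ, Fin.val_castSucc]; push_cast; ring

theorem Beam.node_zero (b : Beam) (N : ℕ) : b.node N 0 = 0 := by simp [Beam.node]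

theorem Beam.node_last (b : Beam) (N : ℕ) : b.node N (Fin.last (N + 1)) = b.L := by
  simp only [Beam.node, Fin.val_last]; push_cast; rw [mul_comm, b.h_mul]

theorem Beam.node_mem (b : Beam) (N : ℕ) (j : Fin (N + 2)) : b.node N j ∈ Icc 0 b.L := by
  have h := b.h_pos N
  refine ⟨by unfold Beam.node; positivity, ?_⟩
  rw [← b.node_last N]
  unfold Beam.node
  gcongr
  exact Fin.le_last j

theorem Beam.cell_subset (b : Beam) (N : ℕ) (j : Fin (N + 1)) :
    Ioo (b.mid N j - b.h N / 2) (b.mid N j + b.h N / 2) ⊆ Ioo 0 b.L := by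
  rw [← b.node_castSucc, ← b.node_succ]
  exact Ioo_subset_Ioo (b.node_mem N _).1 (b.node_mem N _).2

theorem Beam.exists_avg_remainder {b : Beam} {φ φ₁ φ₂ : b.X} (h1 : b.HasDx φ φ₁)
    (h2 : b.HasDx φ₁ φ₂) (N : ℕ) (j : Fin (N + 1)) :
    ∃ ξ ∈ Icc (b.node N j.castSucc) (b.node N j.succ),
      avg (fun i => b.at (b.node N i) φ) j - b.at (b.mid N j) φ
        = b.h N ^ 2 * (1 / 8 * b.at ξ φ₂) := by
  have h := b.h_pos N
  -- With half-width H = h/2 the remainder H²/2 becomes h²/8; for the difference quotient, H³/(3h)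
  -- becomes h²/24.
  obtain ⟨ξ, hξ, e⟩ := exists_second_difference (half_pos h) (b.continuous_at φ)
    (fun x hx => h1.hasDerivAt (b.cell_subset N j hx))
    (fun x hx => h2.hasDerivAt (b.cell_subset N j hx))
  refine ⟨ξ, ?_, ?_⟩
  · rw [b.node_castSucc, b.node_succ]; exact Ioo_subset_Icc_self hξ
  · rw [avg, b.node_castSucc, b.node_succ]; linear_combination e / 2

theorem Beam.exists_δ_remainder {b : Beam} {φ φ₁ φ₂ φ₃ : b.X} (h1 : b.HasDx φ φ₁)
    (h2 : b.HasDx φ₁ φ₂) (h3 : b.HasDx φ₂ φ₃) (N : ℕ) (j : Fin (N + 1)) :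
    ∃ ξ ∈ Icc (b.node N j.castSucc) (b.node N j.succ),
      b.δ (fun i => b.at (b.node N i) φ) j - b.at (b.mid N j) φ₁
        = b.h N ^ 2 * (1 / 24 * b.at ξ φ₃) := by
  have h := b.h_pos N
  obtain ⟨ξ, hξ, e⟩ := exists_first_difference (half_pos h) (b.continuous_at φ)
    (b.continuous_at φ₁)
    (fun x hx => h1.hasDerivAt (b.cell_subset N j hx))
    (fun x hx => h2.hasDerivAt (b.cell_subset N j hx))
    (fun x hx => h3.hasDerivAt (b.cell_subset N j hx))
  refine ⟨ξ, ?_, ?_⟩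
  · rw [b.node_castSucc, b.node_succ]; exact Ioo_subset_Icc_self hξ
  · rw [Beam.δ, b.node_castSucc, b.node_succ, sub_eq_iff_eq_add, div_eq_iff h.ne']
    linear_combination e

/-! ### The solution as a curve in `C[0,L]⁴` -/

/-- The components of a field. -/
def Field.comp (f : Field) : Fin 4 → ℝ → ℝ → ℝ := ![f.u₁, f.u₂, f.w₁, f.w₂]

/-- `F i` is the curve of `i`-th space derivatives of `f`, for `i ≤ 3`. -/
structure Lift (b : Beam) (f : Field) (F : ℕ → ℝ → b.Q) : Prop where
  cont : ∀ i ≤ 3, ContinuousOn (F i) (Ici 0)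
  diff : ∀ i ≤ 3, ∀ t > 0, DifferentiableAt ℝ (F i) t
  at_eq : ∀ i ≤ 3, ∀ t ≥ 0, ∀ x ∈ Icc 0 b.L, ∀ k,
    b.at x (F i t k) = b.Dx i (fun y => f.comp k y t) x
  dx : ∀ i < 3, ∀ t ≥ 0, b.HasDxQ (F i t) (F (i + 1) t)

theorem Field.IsC1C3.comp {b : Beam} {f : Field} (h : f.IsC1C3 b) (k : Fin 4) :
    Piezo.IsC1C3 b.L (f.comp k) := by
  fin_cases k
  · exact h.u₁
  · exact h.u₂
  · exact h.w₁
  · exact h.w₂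

theorem Field.IsC1C3.exists_lift {b : Beam} {f : Field} (h : f.IsC1C3 b) :
    ∃ F : ℕ → ℝ → b.Q, Lift b f F := by
  have h1 : ∀ (k : Fin 4) (i : ℕ), ∃ F : ℝ → b.X, i ≤ 3 → ContDiffOn ℝ 1 F (Ici 0) ∧
      ∀ t ∈ Ici (0 : ℝ), ∀ x : Icc (0 : ℝ) b.L,
      F t x = iteratedDerivWithin i (fun y => f.comp k y t) (Icc 0 b.L) x := by
    intro k i
    by_cases hi : i ≤ 3
    · obtain ⟨F, hF⟩ := (h.comp k).2 i hi
      exact ⟨F, fun _ => hF⟩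
    -- Regularity stops at order 3; the curves of higher index are never used.
    · exact ⟨0, fun h => (hi h).elim⟩
  choose F hF using h1
  have hat : ∀ i ≤ 3, ∀ t ≥ 0, ∀ x ∈ Icc 0 b.L, ∀ k,
      b.at x (F k i t) = b.Dx i (fun y => f.comp k y t) x := by
    intro i hi t ht x hx k
    rw [b.at_apply, projIcc_of_mem _ hx, (hF k i hi).2 t ht]; rfl
  refine ⟨fun i t k => F k i t, ⟨fun i hi => ?_, fun i hi t ht => ?_, hat, fun i hi t ht k => ?_⟩⟩
  · exact continuousOn_pi.2 fun k => (hF k i hi).1.continuousOn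
  · refine differentiableAt_pi.2 fun k => ?_
    exact ((hF k i hi).1.differentiableOn one_ne_zero).differentiableAt (Ici_mem_nhds ht)
  · refine b.hasDx_of_hasDerivAt fun x hx => ?_
    have hxI := Ioo_subset_Icc_self hx
    have hd := ((h.comp k).1 t ht).differentiableOn_iteratedDerivWithin (m := i)
      (by exact_mod_cast hi) (uniqueDiffOn_Icc b.L_pos) x hxI
    have hn := Icc_mem_nhds hx.1 hx.2
    have hd' := hd.hasDerivWithinAt.hasDerivAt hn
    rw [hat (i + 1) hi t ht x hxI k, Beam.Dx, iteratedDerivWithin_succ]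
    refine hd'.congr_of_eventuallyEq ?_
    filter_upwards [hn] with y hy
    exact hat i (by omega) t ht y hy k

/-- The endpoints are covered too: `b.at` extends ψ continuously by constants, so its primitive is
differentiable on the whole line. -/
theorem Beam.HasDx.hasDerivWithinAt {b : Beam} {φ ψ : b.X} (h : b.HasDx φ ψ) {x : ℝ}
    (hx : x ∈ Icc 0 b.L) : HasDerivWithinAt (fun y => b.at y φ) (b.at x ψ) (Icc 0 b.L) x := by
  have h1 : HasDerivAt (fun y => b.at 0 φ + b.prim y ψ) (b.at x ψ) x :=
    (intervalIntegral.integral_hasDerivAt_right ((b.continuous_at ψ).intervalIntegrable _ _)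
      ((b.continuous_at ψ).stronglyMeasurableAtFilter _ _)
      (b.continuous_at ψ).continuousAt).const_add _
  refine h1.hasDerivWithinAt.congr (fun y hy => ?_) ?_
  · rw [← h y hy]; ring
  · rw [← h x hx]; ring

theorem Beam.HasDx.Dx_two {b : Beam} {φ φ₁ φ₂ : b.X} (h : b.HasDx φ φ₁) (h' : b.HasDx φ₁ φ₂)
    {ψ : ℝ → ℝ} (hψ : ∀ x ∈ Icc 0 b.L, ψ x = b.at x φ) {x : ℝ} (hx : x ∈ Icc 0 b.L) :
    b.Dx 2 ψ x = b.at x φ₂ := by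
  have u := uniqueDiffOn_Icc b.L_pos
  have e1 : EqOn (iteratedDerivWithin 1 ψ (Icc 0 b.L)) (fun y => b.at y φ₁) (Icc 0 b.L) := by
    intro y hy
    rw [iteratedDerivWithin_one]
    exact ((h.hasDerivWithinAt hy).congr hψ (hψ y hy)).derivWithin (u y hy)
  rw [Beam.Dx, iteratedDerivWithin_succ, derivWithin_congr e1 (e1 hx)]
  exact (h'.hasDerivWithinAt hx).derivWithin (u x hx)

/-! ### Time derivatives of the solution and uniform bounds -/

namespace Lift

variable {b : Beam} {f : Field} {F : ℕ → ℝ → b.Q}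

theorem at_zero (l : Lift b f F) {t : ℝ} (ht : 0 ≤ t) {x : ℝ} (hx : x ∈ Icc 0 b.L) (k : Fin 4) :
    b.at x (F 0 t k) = f.comp k x t := by
  rw [l.at_eq 0 (by norm_num) t ht x hx k, Beam.Dx, iteratedDerivWithin_zero]

theorem hasDerivAt_comp (l : Lift b f F) {t : ℝ} (ht : 0 < t) {x : ℝ} (hx : x ∈ Icc 0 b.L)
    (k : Fin 4) : HasDerivAt (fun τ => f.comp k x τ) (b.at x (deriv (F 0) t k)) t := by
  have h := hasDerivAt_pi.1 (l.diff 0 (by norm_num) t ht).hasDerivAt k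
  refine ((b.at x).hasFDerivAt.comp_hasDerivAt t h).congr_of_eventuallyEq ?_
  filter_upwards [lt_mem_nhds ht] with τ hτ
  exact (l.at_zero hτ.le hx k).symm

theorem deriv_comp (l : Lift b f F) {t : ℝ} (ht : 0 < t) {x : ℝ} (hx : x ∈ Ioo 0 b.L)
    (k : Fin 4) : deriv (fun y => f.comp k y t) x = b.at x (F 1 t k) := by
  refine HasDerivAt.deriv (((l.dx 0 (by norm_num) t ht.le k).hasDerivAt hx).congr_of_eventuallyEq ?_)
  filter_upwards [Ioo_mem_nhds hx.1 hx.2] with y hy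
  exact (l.at_zero ht.le (Ioo_subset_Icc_self hy) k).symm

theorem dx_deriv (l : Lift b f F) {t : ℝ} (ht : 0 < t) {i : ℕ} (hi : i < 3) :
    b.HasDxQ (deriv (F i) t) (deriv (F (i + 1)) t) := fun k =>
  Beam.HasDx.time_deriv ((lt_mem_nhds ht).mono fun τ hτ => l.dx i hi τ (le_of_lt hτ) k)
    (hasDerivAt_pi.1 (l.diff i hi.le t ht).hasDerivAt k)
    (hasDerivAt_pi.1 (l.diff (i + 1) hi t ht).hasDerivAt k)

/-- The differential equations. -/
theorem deriv_zero (l : Lift b f F) (hp : f.SolvesPDE b) {t : ℝ} (ht : 0 < t) :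
    deriv (F 0) t = b.A (F 1 t) := by
  have hρ := b.ρ_pos.ne'
  have hμ := b.μ_pos.ne'
  have d := fun x (hx : x ∈ Ioo 0 b.L) (k : Fin 4) =>
    (l.hasDerivAt_comp ht (Ioo_subset_Icc_self hx) k).deriv
  funext k
  refine b.ext_of_Ioo fun x hx => ?_
  have m1 := hp.momentum₁ x hx t ht
  have m2 := hp.momentum₂ x hx t ht
  have c1 := hp.compat₁ x hx t ht
  have c2 := hp.compat₂ x hx t ht
  rw [show deriv (fun τ => f.w₁ x τ) t = _ from d x hx 2,
    show deriv (fun y => f.u₁ y t) x = _ from l.deriv_comp ht hx 0,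
    show deriv (fun y => f.u₂ y t) x = _ from l.deriv_comp ht hx 1] at m1
  rw [show deriv (fun τ => f.w₂ x τ) t = _ from d x hx 3,
    show deriv (fun y => f.u₁ y t) x = _ from l.deriv_comp ht hx 0,
    show deriv (fun y => f.u₂ y t) x = _ from l.deriv_comp ht hx 1] at m2
  rw [show deriv (fun τ => f.u₁ x τ) t = _ from d x hx 0,
    show deriv (fun y => f.w₁ y t) x = _ from l.deriv_comp ht hx 2] at c1
  rw [show deriv (fun τ => f.u₂ x τ) t = _ from d x hx 1,
    show deriv (fun y => f.w₂ y t) x = _ from l.deriv_comp ht hx 3] at c2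
  fin_cases k
  · change b.at x (deriv (F 0) t 0) = b.at x (b.A (F 1 t) 0)
    rw [b.A_zero]; linarith
  · change b.at x (deriv (F 0) t 1) = b.at x (b.A (F 1 t) 1)
    rw [b.A_one]; linarith
  · change b.at x (deriv (F 0) t 2) = b.at x (b.A (F 1 t) 2)
    rw [b.A_two, map_add, map_smul, map_smul, smul_eq_mul, smul_eq_mul]
    field_simp; linarith
  · change b.at x (deriv (F 0) t 3) = b.at x (b.A (F 1 t) 3)
    rw [b.A_three, map_add, map_smul, map_smul, smul_eq_mul, smul_eq_mul]
    field_simp; linarith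

/-- The equation may be differentiated in space: by induction both sides are space derivatives of
the same curve. The index stays below 3, since there is no fourth space derivative. -/
theorem deriv_eq (l : Lift b f F) (hp : f.SolvesPDE b) {t : ℝ} (ht : 0 < t) {i : ℕ}
    (hi : i < 3) : deriv (F i) t = b.A (F (i + 1) t) := by
  induction i with
  | zero => exact l.deriv_zero hp ht
  | succ n ih =>
    have h1 := l.dx_deriv ht (i := n) (by omega)
    rw [ih (by omega)] at h1
    exact h1.unique (l.dx (n + 1) hi t ht.le).A

theorem bdry_zero (l : Lift b f F) (hp : f.SolvesPDE b) {t : ℝ} (ht : 0 < t) :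
    b.bdry (F 0 t) = 0 := by
  have h0 : (0 : ℝ) ∈ Icc 0 b.L := left_mem_Icc.2 b.L_pos.le
  have hL : b.L ∈ Icc 0 b.L := right_mem_Icc.2 b.L_pos.le
  have c1 := hp.clamped₁ t ht
  have c2 := hp.clamped₂ t ht
  have f1 := hp.feedback₁ t ht
  have f2 := hp.feedback₂ t ht
  funext k
  simp only [Beam.bdry, l.at_zero ht.le h0, l.at_zero ht.le hL]
  fin_cases k
  · simpa [Field.comp] using c1
  · simpa [Field.comp] using c2
  · simp [Field.comp]; linarith
  · simp [Field.comp]; linarith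

theorem isSol_zero (l : Lift b f F) (hp : f.SolvesPDE b) : IsSol b (F 0) (F 1) where
  dx t ht := l.dx 0 (by norm_num) t (le_of_lt ht)
  dt t ht := by
    rw [← l.deriv_zero hp ht]; exact (l.diff 0 (by norm_num) t ht).hasDerivAt
  bc t ht := l.bdry_zero hp ht

theorem hasDerivAt_iterate (l : Lift b f F) {t : ℝ} (ht : 0 < t) {i : ℕ}
    (hi : i ≤ 3) (n : ℕ) :
    HasDerivAt (fun τ => b.A^[n] (F i τ)) (b.A^[n] (deriv (F i) t)) t := by
  induction n with
  | zero => exact (l.diff i hi t ht).hasDerivAt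
  | succ n ih =>
    simp only [Function.iterate_succ_apply']
    exact b.A.hasFDerivAt.comp_hasDerivAt t ih

/-- Here A^i ∂ₓ^i U is the i-th time derivative of U, and the boundary conditions, being linear and
independent of time, survive differentiation in time. -/
theorem bdry_iterate (l : Lift b f F) (hp : f.SolvesPDE b) {i : ℕ} (hi : i ≤ 3) {t : ℝ}
    (ht : 0 < t) : b.bdry (b.A^[i] (F i t)) = 0 := by
  induction i generalizing t with
  | zero => exact l.bdry_zero hp ht
  | succ n ih =>
    have h := Beam.bdry_time_deriv (l.hasDerivAt_iterate ht (i := n) (by omega) n)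
      ((lt_mem_nhds ht).mono fun τ hτ => ih (by omega) hτ)
    rwa [l.deriv_eq hp ht (by omega), ← Function.iterate_succ_apply] at h

/-- The third time derivative is a classical solution. -/
theorem isSol_three (l : Lift b f F) (hp : f.SolvesPDE b) :
    IsSol b (fun t => b.A (b.A (b.A (F 3 t)))) (fun t => b.A (b.A (deriv (F 3) t))) where
  dx t ht := by
    -- Writing A ∂ₓ³U as the time derivative of ∂ₓ²U makes it differentiable in space; its space
    -- derivative is the time derivative of ∂ₓ³U, which exists because U is C¹ in time with values
    -- in C³.
    rw [← l.deriv_eq hp ht (i := 2) (by norm_num)]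
    exact (l.dx_deriv ht (i := 2) (by norm_num)).A.A
  dt t ht := l.hasDerivAt_iterate ht le_rfl 3
  bc t ht := l.bdry_iterate hp le_rfl ht

/-- The third space derivatives are bounded. -/
theorem exists_bound (l : Lift b f F) (hp : f.SolvesPDE b) :
    ∃ C > 0, ∀ t > 0, ‖F 3 t‖ ≤ C ∧ ‖deriv (F 2) t‖ ≤ C := by
  obtain ⟨C, h⟩ := (l.isSol_three hp).exists_norm_le
  obtain ⟨K, hK, hA⟩ := b.exists_norm_le_A
  -- Compactness covers times up to 1. Later, the bound on A³∂ₓ³U is pulled back through the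
  -- invertible A three times.
  obtain ⟨D, hD⟩ := isCompact_Icc.exists_bound_of_continuousOn
    ((l.cont 3 le_rfl).mono (Icc_subset_Ici_self : Icc (0 : ℝ) 1 ⊆ Ici 0))
  set M := |D| + K * (K * (K * |C|)) + 1 with hM
  have hM0 : 0 < M := by positivity
  have h3 : ∀ t > 0, ‖F 3 t‖ ≤ M := by
    intro t ht
    rcases le_total t 1 with h1 | h1
    · have p : 0 ≤ K * (K * (K * |C|)) := by positivity
      linarith [hD t ⟨le_of_lt ht, h1⟩, le_abs_self D]
    · have : ‖F 3 t‖ ≤ K * (K * (K * |C|)) := by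
        refine (hA _).trans (mul_le_mul_of_nonneg_left ?_ hK.le)
        refine (hA _).trans (mul_le_mul_of_nonneg_left ?_ hK.le)
        refine (hA _).trans (mul_le_mul_of_nonneg_left ?_ hK.le)
        exact (h t h1).trans (le_abs_self C)
      linarith [abs_nonneg D]
  refine ⟨M + ‖b.A‖ * M, by positivity, fun t ht => ⟨?_, ?_⟩⟩
  · have : 0 ≤ ‖b.A‖ * M := by positivity
    linarith [h3 t ht]
  · rw [l.deriv_eq hp ht (by norm_num)]
    refine (b.A.le_opNorm _).trans ?_
    have := mul_le_mul_of_nonneg_left (h3 t ht) (norm_nonneg b.A)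
    linarith

theorem energy_eq (l : Lift b f F) {t : ℝ} (ht : 0 ≤ t) : f.energy b t = b.En (F 0 t) := by
  rw [Field.energy, Beam.En, Beam.prim_apply, ← intervalIntegral.integral_const_mul]
  refine intervalIntegral.integral_congr fun x hx => ?_
  rw [uIcc_of_le b.L_pos.le] at hx
  simp only [b.at_dens, l.at_zero ht hx, Beam.α₁]
  simp [Field.comp]
  ring

end Lift

/-! ### The truncation error -/

/-- The residual of the nodal values of a curve `F₀` with time derivative `G` in the ORFD
system. -/
noncomputable def Beam.residual (b : Beam) (N : ℕ) (F₀ G : ℝ → b.Q) : Residual N where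
  r₁ := fun t j => avg (fun i => b.at (b.node N i) (G t 0)) j
    - b.δ (fun i => b.at (b.node N i) (F₀ t 2)) j
  r₂ := fun t j => avg (fun i => b.at (b.node N i) (G t 1)) j
    - b.δ (fun i => b.at (b.node N i) (F₀ t 3)) j
  s₁ := fun t j => b.ρ * avg (fun i => b.at (b.node N i) (G t 2)) j
    - b.α * b.δ (fun i => b.at (b.node N i) (F₀ t 0)) j
    + b.γ * b.β * b.δ (fun i => b.at (b.node N i) (F₀ t 1)) j
  s₂ := fun t j => b.μ * avg (fun i => b.at (b.node N i) (G t 3)) j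
    - b.β * b.δ (fun i => b.at (b.node N i) (F₀ t 1)) j
    + b.γ * b.β * b.δ (fun i => b.at (b.node N i) (F₀ t 0)) j

theorem avg_sub {N : ℕ} (U V : Fin (N + 2) → ℝ) (j : Fin (N + 1)) :
    avg (fun i => U i - V i) j = avg U j - avg V j := by
  simp only [avg]; ring

theorem Beam.δ_sub (b : Beam) {N : ℕ} (U V : Fin (N + 2) → ℝ) (j : Fin (N + 1)) :
    b.δ (fun i => U i - V i) j = b.δ U j - b.δ V j := by
  simp only [Beam.δ]; ring

namespace Lift

variable {b : Beam} {f : Field} {F : ℕ → ℝ → b.Q}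

/-- The differential equations hold exactly at the midpoint of each cell, so only the remainders of
the average and of the difference quotient are left. -/
theorem residual_eq (l : Lift b f F) (hp : f.SolvesPDE b) (N : ℕ) {t : ℝ} (ht : 0 < t)
    (j : Fin (N + 1)) :
    ∃ ξ : Fin 8 → ℝ, (∀ i, ξ i ∈ Icc (b.node N j.castSucc) (b.node N j.succ)) ∧
      (b.residual N (F 0) (deriv (F 0))).s₁ t j = b.h N ^ 2 *
        (b.ρ / 8 * b.at (ξ 0) (deriv (F 2) t 2) - b.α / 24 * b.at (ξ 1) (F 3 t 0)
          + b.γ * b.β / 24 * b.at (ξ 2) (F 3 t 1)) ∧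
      (b.residual N (F 0) (deriv (F 0))).s₂ t j = b.h N ^ 2 *
        (b.μ / 8 * b.at (ξ 3) (deriv (F 2) t 3) - b.β / 24 * b.at (ξ 2) (F 3 t 1)
          + b.γ * b.β / 24 * b.at (ξ 1) (F 3 t 0)) ∧
      (b.residual N (F 0) (deriv (F 0))).r₁ t j = b.h N ^ 2 *
        (1 / 8 * b.at (ξ 4) (deriv (F 2) t 0) - 1 / 24 * b.at (ξ 5) (F 3 t 2)) ∧
      (b.residual N (F 0) (deriv (F 0))).r₂ t j = b.h N ^ 2 *
        (1 / 8 * b.at (ξ 6) (deriv (F 2) t 1) - 1 / 24 * b.at (ξ 7) (F 3 t 3)) := by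
  have ha := fun k => Beam.exists_avg_remainder (l.dx_deriv ht (i := 0) (by norm_num) k)
    (l.dx_deriv ht (i := 1) (by norm_num) k) N j
  have hδ := fun k => Beam.exists_δ_remainder (l.dx 0 (by norm_num) t ht.le k)
    (l.dx 1 (by norm_num) t ht.le k) (l.dx 2 (by norm_num) t ht.le k) N j
  choose ζ hζ eζ using ha
  choose θ hθ eθ using hδ
  have hρ := b.ρ_pos.ne'
  have hμ := b.μ_pos.ne'
  have p := l.deriv_zero hp ht
  have p0 : b.at (b.mid N j) (deriv (F 0) t 0) = b.at (b.mid N j) (F 1 t 2) := by rw [p, b.A_zero]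
  have p1 : b.at (b.mid N j) (deriv (F 0) t 1) = b.at (b.mid N j) (F 1 t 3) := by rw [p, b.A_one]
  have p2 : b.ρ * b.at (b.mid N j) (deriv (F 0) t 2) = b.α * b.at (b.mid N j) (F 1 t 0)
      - b.γ * b.β * b.at (b.mid N j) (F 1 t 1) := by
    rw [p, b.A_two, map_add, map_smul, map_smul, smul_eq_mul, smul_eq_mul]; field_simp; ring
  have p3 : b.μ * b.at (b.mid N j) (deriv (F 0) t 3) = b.β * b.at (b.mid N j) (F 1 t 1)
      - b.γ * b.β * b.at (b.mid N j) (F 1 t 0) := by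
    rw [p, b.A_three, map_add, map_smul, map_smul, smul_eq_mul, smul_eq_mul]; field_simp; ring
  -- Both momentum equations involve the same quotients δₓu₁ and δₓu₂, hence share the points θ 0
  -- and θ 1.
  refine ⟨![ζ 2, θ 0, θ 1, ζ 3, ζ 0, θ 2, ζ 1, θ 3], ?_, ?_, ?_, ?_, ?_⟩
  · intro i
    fin_cases i
    exacts [hζ 2, hθ 0, hθ 1, hζ 3, hζ 0, hθ 2, hζ 1, hθ 3]
  · simp only [Beam.residual, Matrix.cons_val]
    linear_combination p2 + b.ρ * eζ 2 - b.α * eθ 0 + b.γ * b.β * eθ 1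
  · simp only [Beam.residual, Matrix.cons_val]
    linear_combination p3 + b.μ * eζ 3 - b.β * eθ 1 + b.γ * b.β * eθ 0
  · simp only [Beam.residual, Matrix.cons_val]
    linear_combination p0 + eζ 0 - eθ 2
  · simp only [Beam.residual, Matrix.cons_val]
    linear_combination p1 + eζ 1 - eθ 3

theorem isTruncationError (l : Lift b f F) (hp : f.SolvesPDE b) (N : ℕ) :
    (b.residual N (F 0) (deriv (F 0))).IsTruncationError b f := by
  intro t ht j
  obtain ⟨ξ, hξ, e⟩ := l.residual_eq hp N ht j
  have hI : ∀ i, ξ i ∈ Icc 0 b.L := fun i =>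
    ⟨(b.node_mem N _).1.trans (hξ i).1, (hξ i).2.trans (b.node_mem N _).2⟩
  have e2 : ∀ i k, b.at (ξ i) (deriv (F 2) t k)
      = b.Dx 2 (fun x => deriv (fun τ => f.comp k x τ) t) (ξ i) := fun i k =>
    (Beam.HasDx.Dx_two (l.dx_deriv ht (i := 0) (by norm_num) k)
      (l.dx_deriv ht (i := 1) (by norm_num) k) (fun x hx => (l.hasDerivAt_comp ht hx k).deriv)
      (hI i)).symm
  have e3 : ∀ i k, b.at (ξ i) (F 3 t k) = b.Dx 3 (fun x => f.comp k x t) (ξ i) := fun i k =>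
    l.at_eq 3 le_rfl t ht.le (ξ i) (hI i) k
  simp only [e2, e3] at e
  exact ⟨ξ, hξ, e⟩

/-- The truncation error is of second order, uniformly in time. -/
theorem exists_residual_le (l : Lift b f F) (hp : f.SolvesPDE b) : ∃ C > 0, ∀ N, ∀ t > 0, ∀ j,
    let R := b.residual N (F 0) (deriv (F 0))
    |R.s₁ t j| ≤ C * b.h N ^ 2 ∧ |R.s₂ t j| ≤ C * b.h N ^ 2 ∧
      |R.r₁ t j| ≤ C * b.h N ^ 2 ∧ |R.r₂ t j| ≤ C * b.h N ^ 2 := by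
  obtain ⟨C, hC, hb⟩ := l.exists_bound hp
  have hρ := b.ρ_pos
  have hμ := b.μ_pos
  have hα := b.α_pos
  have hβ := b.β_pos
  have hγβ := mul_pos b.γ_pos hβ
  refine ⟨(1 + b.ρ + b.μ + b.α + b.β + b.γ * b.β) * C, by positivity, fun N t ht j => ?_⟩
  obtain ⟨ξ, -, e1, e2, e3, e4⟩ := l.residual_eq hp N ht j
  have B2 : ∀ i k, |b.at (ξ i) (deriv (F 2) t k)| ≤ C := fun i k =>
    (b.abs_at_le_norm _ _ _).trans (hb t ht).2
  have B3 : ∀ i k, |b.at (ξ i) (F 3 t k)| ≤ C := fun i k =>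
    (b.abs_at_le_norm _ _ _).trans (hb t ht).1
  have q : ∀ {c x : ℝ}, 0 ≤ c → |x| ≤ C → |c * x| ≤ c * C := fun hc hx => by
    rw [abs_mul, abs_of_nonneg hc]; exact mul_le_mul_of_nonneg_left hx hc
  have hρC := mul_pos hρ hC
  have hμC := mul_pos hμ hC
  have hαC := mul_pos hα hC
  have hβC := mul_pos hβ hC
  have hγC := mul_pos hγβ hC
  have fin : ∀ y : ℝ, |y| ≤ (1 + b.ρ + b.μ + b.α + b.β + b.γ * b.β) * C →
      |b.h N ^ 2 * y| ≤ (1 + b.ρ + b.μ + b.α + b.β + b.γ * b.β) * C * b.h N ^ 2 := by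
    intro y hy
    rw [abs_mul, abs_of_nonneg (sq_nonneg _), mul_comm]
    exact mul_le_mul_of_nonneg_right hy (sq_nonneg _)
  simp only
  rw [e1, e2, e3, e4]
  refine ⟨fin _ ?_, fin _ ?_, fin _ ?_, fin _ ?_⟩
  · have a1 := q (by positivity : 0 ≤ b.ρ / 8) (B2 0 2)
    have a2 := q (by positivity : 0 ≤ b.α / 24) (B3 1 0)
    have a3 := q (by positivity : 0 ≤ b.γ * b.β / 24) (B3 2 1)
    refine (abs_add_le _ _).trans ((add_le_add_left (abs_sub _ _) _).trans ?_)
    linarith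
  · have a1 := q (by positivity : 0 ≤ b.μ / 8) (B2 3 3)
    have a2 := q (by positivity : 0 ≤ b.β / 24) (B3 2 1)
    have a3 := q (by positivity : 0 ≤ b.γ * b.β / 24) (B3 1 0)
    refine (abs_add_le _ _).trans ((add_le_add_left (abs_sub _ _) _).trans ?_)
    linarith
  · have a1 := q (by positivity : (0 : ℝ) ≤ 1 / 8) (B2 4 0)
    have a2 := q (by positivity : (0 : ℝ) ≤ 1 / 24) (B3 5 2)
    refine (abs_sub _ _).trans ?_
    linarith
  · have a1 := q (by positivity : (0 : ℝ) ≤ 1 / 8) (B2 6 1)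
    have a2 := q (by positivity : (0 : ℝ) ≤ 1 / 24) (B3 7 3)
    refine (abs_sub _ _).trans ?_
    linarith

theorem continuousOn_comp (l : Lift b f F) {x : ℝ} (hx : x ∈ Icc 0 b.L) (k : Fin 4) :
    ContinuousOn (fun t => f.comp k x t) (Ici 0) := by
  have h : ContinuousOn (fun t => b.at x (F 0 t k)) (Ici 0) :=
    (b.at x).continuous.comp_continuousOn
      ((continuous_apply k).comp_continuousOn (l.cont 0 (by norm_num)))
  exact h.congr fun t ht => (l.at_zero ht hx k).symm

theorem deriv_avg_sub (l : Lift b f F) {N : ℕ} {V : ℝ → Fin (N + 2) → ℝ} {t : ℝ} (ht : 0 < t)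
    (k : Fin 4) (hV : ∀ i, DifferentiableAt ℝ (fun τ => V τ i) t) (j : Fin (N + 1)) :
    deriv (fun τ => avg (fun i => f.comp k (b.node N i) τ - V τ i) j) t =
      avg (fun i => b.at (b.node N i) (deriv (F 0) t k)) j - deriv (fun τ => avg (V τ) j) t := by
  have d := fun i => l.hasDerivAt_comp ht (b.node_mem N i) k
  simp only [avg_sub]
  refine (HasDerivAt.sub ?_ (differentiableAt_avg hV j).hasDerivAt).deriv
  exact ((d _).add (d _)).div_const 2

theorem δ_sub (l : Lift b f F) {N : ℕ} (V : Fin (N + 2) → ℝ) {t : ℝ} (ht : 0 < t)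
    (k : Fin 4) (j : Fin (N + 1)) :
    b.δ (fun i => f.comp k (b.node N i) t - V i) j =
      b.δ (fun i => b.at (b.node N i) (F 0 t k)) j - b.δ V j := by
  rw [b.δ_sub]
  simp only [l.at_zero ht.le (b.node_mem N _)]

/-- The error solves the ORFD system with the truncation error on the right-hand side. -/
theorem solvesORFD_errorFun (l : Lift b f F) (hp : f.SolvesPDE b) {N : ℕ} {g : ℝ → GridData N}
    (hg : SolvesORFD b (Residual.zero N) (f.sample b N 0) g) :
    SolvesORFD b (b.residual N (F 0) (deriv (F 0))) (GridData.zero N) (errorFun b f g) where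
  cont j := ⟨(l.continuousOn_comp (b.node_mem N j) 0).sub (hg.cont j).1,
    (l.continuousOn_comp (b.node_mem N j) 1).sub (hg.cont j).2.1,
    (l.continuousOn_comp (b.node_mem N j) 2).sub (hg.cont j).2.2.1,
    (l.continuousOn_comp (b.node_mem N j) 3).sub (hg.cont j).2.2.2⟩
  diff j t ht := ⟨(l.hasDerivAt_comp ht (b.node_mem N j) 0).differentiableAt.sub (hg.diff j t ht).1,
    (l.hasDerivAt_comp ht (b.node_mem N j) 1).differentiableAt.sub (hg.diff j t ht).2.1,
    (l.hasDerivAt_comp ht (b.node_mem N j) 2).differentiableAt.sub (hg.diff j t ht).2.2.1,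
    (l.hasDerivAt_comp ht (b.node_mem N j) 3).differentiableAt.sub (hg.diff j t ht).2.2.2⟩
  compat₁ t ht j := by
    have d := l.deriv_avg_sub ht 0 (fun i => (hg.diff i t ht).1) j
    have e := l.δ_sub (g t).w₁ ht 2 j
    have z : _ = (0 : ℝ) := hg.compat₁ t ht j
    refine (congrArg₂ (· - ·) d e).trans ?_
    simp only [Beam.residual]
    linear_combination -z
  compat₂ t ht j := by
    have d := l.deriv_avg_sub ht 1 (fun i => (hg.diff i t ht).2.1) j
    have e := l.δ_sub (g t).w₂ ht 3 j
    have z : _ = (0 : ℝ) := hg.compat₂ t ht j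
    refine (congrArg₂ (· - ·) d e).trans ?_
    simp only [Beam.residual]
    linear_combination -z
  momentum₁ t ht j := by
    have d := l.deriv_avg_sub ht 2 (fun i => (hg.diff i t ht).2.2.1) j
    have e := l.δ_sub (g t).u₁ ht 0 j
    have e' := l.δ_sub (g t).u₂ ht 1 j
    have z : _ = (0 : ℝ) := hg.momentum₁ t ht j
    refine (congrArg₂ (· + ·) (congrArg₂ (· - ·) (congrArg (b.ρ * ·) d) (congrArg (b.α * ·) e))
      (congrArg (b.γ * b.β * ·) e')).trans ?_
    simp only [Beam.residual]
    linear_combination -z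
  momentum₂ t ht j := by
    have d := l.deriv_avg_sub ht 3 (fun i => (hg.diff i t ht).2.2.2) j
    have e := l.δ_sub (g t).u₂ ht 1 j
    have e' := l.δ_sub (g t).u₁ ht 0 j
    have z : _ = (0 : ℝ) := hg.momentum₂ t ht j
    refine (congrArg₂ (· + ·) (congrArg₂ (· - ·) (congrArg (b.μ * ·) d) (congrArg (b.β * ·) e))
      (congrArg (b.γ * b.β * ·) e')).trans ?_
    simp only [Beam.residual]
    linear_combination -z
  clamped₁ t ht := by
    simp only [errorFun, Field.sample, b.node_zero]
    rw [hp.clamped₁ t ht, hg.clamped₁ t ht, sub_zero]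
  clamped₂ t ht := by
    simp only [errorFun, Field.sample, b.node_zero]
    rw [hp.clamped₂ t ht, hg.clamped₂ t ht, sub_zero]
  feedback₁ t ht := by
    simp only [errorFun, Field.sample, b.node_last]
    linear_combination hp.feedback₁ t ht - hg.feedback₁ t ht
  feedback₂ t ht := by
    simp only [errorFun, Field.sample, b.node_last]
    linear_combination hp.feedback₂ t ht - hg.feedback₂ t ht
  init := by
    simp only [errorFun, hg.init, sub_self, GridData.zero]

end Lift

/-! ### Comparison of the energies -/

/-- If the error energy `e` has dissipation `p` and power at most `a √e`, and the dissipations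
`d₁`, `d₂` of two energies `E₁`, `E₂` differ by at most a multiple of `√p √(d₁ + d₂)`, then
`E₂ - E₁` grows slowly. -/
theorem abs_energy_sub_le {e E₁ E₂ p q d₁ d₂ : ℝ → ℝ} {a : ℝ} (ha : 0 ≤ a)
    (ce : ContinuousOn e (Ici 0)) (c₁ : ContinuousOn E₁ (Ici 0)) (c₂ : ContinuousOn E₂ (Ici 0))
    (he : ∀ t > 0, HasDerivAt e (-p t + q t) t)
    (h₁ : ∀ t > 0, HasDerivAt E₁ (-d₁ t) t) (h₂ : ∀ t > 0, HasDerivAt E₂ (-d₂ t) t)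
    (hp : ∀ t > 0, 0 ≤ p t) (hq : ∀ t > 0, |q t| ≤ a * √(e t))
    (hd : ∀ t > 0, ∀ l > 0, |d₁ t - d₂ t| ≤ l / 2 * p t + l⁻¹ * (d₁ t + d₂ t))
    (ne : ∀ t, 0 ≤ e t) (n₁ : ∀ t, 0 ≤ E₁ t) (n₂ : ∀ t, 0 ≤ E₂ t) (e0 : e 0 = 0)
    {T : ℝ} (hT : 0 ≤ T) {l : ℝ} (hl : 0 < l) :
    |E₂ T - E₁ T| ≤ |E₂ 0 - E₁ 0| + l⁻¹ * (E₁ 0 + E₂ 0) + l / 2 * (a * T) ^ 2 := by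
  have sub : Icc 0 T ⊆ Ici 0 := Icc_subset_Ici_self
  have h0 : (0 : ℝ) ∈ Icc 0 T := left_mem_Icc.2 hT
  obtain ⟨τ, hτ, hmax⟩ := isCompact_Icc.exists_isMaxOn ⟨0, h0⟩ (ce.mono sub)
  set M := √(e τ) with hM
  have hM0 : 0 ≤ M := Real.sqrt_nonneg _
  have hq' : ∀ t ∈ Ioo 0 T, |q t| ≤ a * M := fun t ht =>
    (hq t ht.1).trans (mul_le_mul_of_nonneg_left
      (Real.sqrt_le_sqrt (hmax (Ioo_subset_Icc_self ht))) ha)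
  -- Integrating e' ≤ aM up to the maximum point gives M² ≤ aMT, a Gronwall bound that is linear in
  -- T.
  have hMT : M ≤ a * T := by
    have anti : AntitoneOn (fun t => e t - a * M * t) (Icc 0 T) := by
      refine antitoneOn_of_hasDerivWithinAt_nonpos (convex_Icc 0 T)
        (f' := fun t => -p t + q t - a * M * 1) ((ce.mono sub).sub (by fun_prop)) ?_ ?_
      · intro t ht
        rw [interior_Icc] at ht
        exact ((he t ht.1).sub ((hasDerivAt_id t).const_mul _)).hasDerivWithinAt
      · intro t ht
        rw [interior_Icc] at ht
        linarith [hp t ht.1, (abs_le.1 (hq' t ht)).2]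
    have h := anti h0 hτ hτ.1
    simp only [e0, mul_zero, sub_zero] at h
    have hs : M * M = e τ := Real.mul_self_sqrt (ne τ)
    have h2 : a * M * τ ≤ a * M * T := mul_le_mul_of_nonneg_left hτ.2 (mul_nonneg ha hM0)
    by_contra! hc
    have : 0 ≤ a * T := mul_nonneg ha hT
    nlinarith
  have key : ∀ σ : ℝ, |σ| = 1 →
      σ * (E₂ T - E₁ T) ≤ σ * (E₂ 0 - E₁ 0) + l⁻¹ * (E₁ 0 + E₂ 0) + l / 2 * (a * T) ^ 2 := by
    intro σ hσ
    -- This is Cauchy–Schwarz in time in Young's form: the dissipations released by e and by E₁ + E₂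
    -- pay for |d₁ - d₂|, and the linear term pays for the power. The signs σ = ±1 give the two
    -- sides of the absolute value.
    have anti : AntitoneOn (fun t => σ * (E₂ t - E₁ t) + l / 2 * e t + l⁻¹ * (E₁ t + E₂ t)
        - l / 2 * (a * M) * t) (Icc 0 T) := by
      refine antitoneOn_of_hasDerivWithinAt_nonpos (convex_Icc 0 T)
        (f' := fun t => σ * (-d₂ t - -d₁ t) + l / 2 * (-p t + q t) + l⁻¹ * (-d₁ t + -d₂ t)
          - l / 2 * (a * M) * 1) ?_ ?_ ?_
      · have := ce.mono sub
        have := c₁.mono sub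
        have := c₂.mono sub
        fun_prop
      · intro t ht
        rw [interior_Icc] at ht
        exact ((((((h₂ t ht.1).sub (h₁ t ht.1)).const_mul σ).add ((he t ht.1).const_mul _)).add
          (((h₁ t ht.1).add (h₂ t ht.1)).const_mul _)).sub
          ((hasDerivAt_id t).const_mul _)).hasDerivWithinAt
      · intro t ht
        rw [interior_Icc] at ht
        have x1 : σ * (-d₂ t - -d₁ t) ≤ |d₁ t - d₂ t| := by
          have := le_abs_self (σ * (d₁ t - d₂ t))
          rw [abs_mul, hσ, one_mul] at this
          linarith
        have x2 := hd t ht.1 l hl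
        have x3 : l / 2 * q t ≤ l / 2 * (a * M) :=
          mul_le_mul_of_nonneg_left (abs_le.1 (hq' t ht)).2 (by positivity)
        linarith
    have h := anti h0 (right_mem_Icc.2 hT) hT
    simp only [e0, mul_zero, sub_zero, add_zero] at h
    have y1 : 0 ≤ l / 2 * e T := mul_nonneg (by positivity) (ne T)
    have y2 : 0 ≤ l⁻¹ * (E₁ T + E₂ T) :=
      mul_nonneg (by positivity) (add_nonneg (n₁ T) (n₂ T))
    have y3 : l / 2 * (a * M) * T ≤ l / 2 * (a * T) ^ 2 := by
      have : a * M * T ≤ (a * T) ^ 2 := by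
        nlinarith [mul_le_mul_of_nonneg_left hMT (mul_nonneg ha hT)]
      have := mul_le_mul_of_nonneg_left this (by positivity : 0 ≤ l / 2)
      linarith
    linarith
  have k1 := key 1 (by simp)
  have k2 := key (-1) (by simp)
  have z1 := le_abs_self (E₂ 0 - E₁ 0)
  have z2 := neg_abs_le (E₂ 0 - E₁ 0)
  exact abs_le.2 ⟨by linarith, by linarith⟩

/-- Young's inequality for w² - v² = (w - v)(w + v), followed by (w + v)² ≤ 2(w² + v²). -/
theorem abs_diss_sub_le {k w v l : ℝ} (hk : 0 ≤ k) (hl : 0 < l) :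
    |k * w ^ 2 - k * v ^ 2| ≤ l / 2 * (k * (w - v) ^ 2) + l⁻¹ * (k * w ^ 2 + k * v ^ 2) := by
  have e : ∀ σ : ℝ, l / 2 * (w - v) ^ 2 + l⁻¹ * (w ^ 2 + v ^ 2) - σ * (w ^ 2 - v ^ 2)
      = l / 2 * ((w - v) - σ * l⁻¹ * (w + v)) ^ 2
        + (l⁻¹ * (w ^ 2 + v ^ 2) - σ ^ 2 * l⁻¹ / 2 * (w + v) ^ 2) := by
    intro σ; field_simp; ring
  have n : ∀ σ : ℝ, σ ^ 2 = 1 →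
      0 ≤ l / 2 * (w - v) ^ 2 + l⁻¹ * (w ^ 2 + v ^ 2) - σ * (w ^ 2 - v ^ 2) := by
    intro σ hσ
    rw [e, hσ]
    have : l⁻¹ * (w ^ 2 + v ^ 2) - 1 * l⁻¹ / 2 * (w + v) ^ 2 = l⁻¹ / 2 * (w - v) ^ 2 := by ring
    rw [this]
    positivity
  have n1 := mul_nonneg hk (n 1 (by norm_num))
  have n2 := mul_nonneg hk (n (-1) (by norm_num))
  exact abs_le.2 ⟨by linarith, by linarith⟩

/-- Convergence of the energies, in the range of short and of long times. -/
theorem exists_energy_bound {b : Beam} {f : Field} (hreg : f.IsC1C3 b) (hpde : f.SolvesPDE b)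
    {g : (N : ℕ) → ℝ → GridData N}
    (hg : ∀ N, SolvesORFD b (Residual.zero N) (f.sample b N 0) (g N))
    (hE0 : Tendsto (fun N => (g N 0).energy b) atTop (𝓝 (f.energy b 0))) :
    ∃ c > 0, ∀ (N : ℕ) (t : ℝ), 0 ≤ t →
      |(g N t).energy b - f.energy b t| ≤ |(g N 0).energy b - f.energy b 0|
        + c * min (b.h N ^ 2 * t) (b.h N) := by
  obtain ⟨F, l⟩ := hreg.exists_lift
  have sol := l.isSol_zero hpde
  obtain ⟨C₁, hC₁, hR⟩ := l.exists_residual_le hpde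
  obtain ⟨C₂, hC₂, hP⟩ := b.exists_power_le
  obtain ⟨C₃, hC₃, hdec⟩ := sol.exists_decay (l.cont 0 (by norm_num))
  -- A convergent sequence is bounded, which makes the constant independent of h.
  obtain ⟨B, hB⟩ := hE0.bddAbove_range
  have hB' : ∀ N, (g N 0).energy b ≤ B := fun N => hB ⟨N, rfl⟩
  have cE : ContinuousOn (fun t => b.En (F 0 t)) (Ici 0) :=
    b.continuous_En.comp_continuousOn (l.cont 0 (by norm_num))
  have hE₀ := b.En_nonneg (F 0 0)
  have hB0 : 0 ≤ B := (GridData.energy_nonneg b _).trans (hB' 0)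
  have hzero : ∀ (N : ℕ) (t : ℝ), 0 < t →
      HasDerivAt (fun τ => (g N τ).energy b) (-(g N t).diss b) t := by
    intro N t ht
    refine ((hg N).hasDerivAt_energy ht).congr_deriv ?_
    simp [Residual.power, Residual.zero]
  set c₀ := b.En (F 0 0) + B + (C₂ * C₁) ^ 2 / 2 with hc₀
  have hc₀0 : 0 ≤ c₀ := by positivity
  have short : ∀ (N : ℕ) (t : ℝ), 0 ≤ t →
      |(g N t).energy b - b.En (F 0 t)| ≤ |(g N 0).energy b - b.En (F 0 0)|
        + c₀ * (b.h N ^ 2 * t) := by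
    intro N t ht
    -- The Young parameter chosen below is l = 1/(h²t), which balances l⁻¹ against l(h²t)² and needs
    -- t > 0.
    rcases ht.eq_or_lt with rfl | ht0
    · simp
    have hh := b.h_pos N
    have herr := l.solvesORFD_errorFun hpde (hg N)
    have hLmem : b.L ∈ Icc 0 b.L := right_mem_Icc.2 b.L_pos.le
    have h := abs_energy_sub_le (e := fun t => (errorFun b f (g N) t).energy b)
      (E₁ := fun t => b.En (F 0 t)) (E₂ := fun t => (g N t).energy b)
      (p := fun t => (errorFun b f (g N) t).diss b)
      (q := fun t => (b.residual N (F 0) (deriv (F 0))).power b (errorFun b f (g N) t) t)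
      (d₁ := fun t => b.diss (F 0 t)) (d₂ := fun t => (g N t).diss b)
      (a := C₂ * (C₁ * b.h N ^ 2)) (by positivity)
      herr.continuousOn_energy cE (hg N).continuousOn_energy
      (fun t ht => herr.hasDerivAt_energy ht) (fun t ht => sol.hasDerivAt_En ht)
      (fun t ht => hzero N t ht) (fun t _ => GridData.diss_nonneg b _)
      (fun t ht => hP N _ _ t _ (hR N t ht))
      (fun t ht l' hl' => by
        have w₁ : b.at b.L (F 0 t 2) = f.w₁ b.L t := l.at_zero (le_of_lt ht) hLmem 2
        have w₂ : b.at b.L (F 0 t 3) = f.w₂ b.L t := l.at_zero (le_of_lt ht) hLmem 3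
        simp only [Beam.diss, GridData.diss, errorFun, Field.sample, b.node_last, w₁, w₂]
        have a₁ := abs_diss_sub_le (w := f.w₁ b.L t) (v := (g N t).w₁ (Fin.last _)) b.k₁_pos.le hl'
        have a₂ := abs_diss_sub_le (w := f.w₂ b.L t) (v := (g N t).w₂ (Fin.last _)) b.k₂_pos.le hl'
        rw [add_sub_add_comm]
        refine (abs_add_le _ _).trans ((add_le_add a₁ a₂).trans (le_of_eq ?_))
        ring)
      (fun t => GridData.energy_nonneg b _) (fun t => b.En_nonneg _)
      (fun t => GridData.energy_nonneg b _)
      (by simp only [herr.init, GridData.zero_energy]) ht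
      (l := (b.h N ^ 2 * t)⁻¹) (by positivity)
    refine h.trans ?_
    rw [add_assoc]
    refine add_le_add le_rfl ?_
    have e1 : (b.h N ^ 2 * t)⁻¹ / 2 * (C₂ * (C₁ * b.h N ^ 2) * t) ^ 2
        = (C₂ * C₁) ^ 2 / 2 * (b.h N ^ 2 * t) := by
      field_simp
    rw [e1, inv_inv, hc₀]
    have : b.h N ^ 2 * t * (b.En (F 0 0) + (g N 0).energy b)
        ≤ b.h N ^ 2 * t * (b.En (F 0 0) + B) :=
      mul_le_mul_of_nonneg_left (by linarith [hB' N]) (by positivity)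
    linarith
  refine ⟨c₀ + C₃, by positivity, fun N t ht => ?_⟩
  rw [l.energy_eq ht, l.energy_eq le_rfl]
  have hh := b.h_pos N
  rcases le_total (b.h N * t) 1 with hht | hht
  · have : b.h N ^ 2 * t ≤ b.h N := by nlinarith
    rw [min_eq_left this]
    refine (short N t ht).trans ?_
    have : 0 ≤ C₃ * (b.h N ^ 2 * t) := by positivity
    linarith
  · have : b.h N ≤ b.h N ^ 2 * t := by nlinarith
    rw [min_eq_right this]
    -- At T = 1/h the short-time error h²T and the decay bound C₃/T are both of order h; beyond T
    -- both energies only decrease.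
    set T := (b.h N)⁻¹ with hT
    have hT0 : 0 < T := inv_pos.2 hh
    have hTt : T ≤ t := by rwa [hT, inv_le_iff_one_le_mul₀ hh, mul_comm]
    have m1 : b.En (F 0 t) ≤ b.En (F 0 T) :=
      sol.antitoneOn_En (mem_Ioi.2 hT0) (mem_Ioi.2 (hT0.trans_le hTt)) hTt
    have m2 : (g N t).energy b ≤ (g N T).energy b := by
      have anti : AntitoneOn (fun t => (g N t).energy b) (Ici 0) := by
        refine antitoneOn_of_hasDerivWithinAt_nonpos (convex_Ici 0)
          (f' := fun t => -(g N t).diss b) (hg N).continuousOn_energy ?_ ?_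
        · intro s hs
          rw [interior_Ici] at hs
          exact (hzero N s hs).hasDerivWithinAt
        · intro s _
          linarith [GridData.diss_nonneg b (g N s)]
      exact anti (mem_Ici.2 hT0.le) (mem_Ici.2 ht) hTt
    have m3 : b.En (F 0 T) ≤ C₃ * b.h N := by
      have := hdec T hT0.le
      rwa [hT, inv_mul_le_iff₀ hh, ← hT, mul_comm] at this
    have m4 := short N T hT0.le
    have e1 : b.h N ^ 2 * T = b.h N := by rw [hT]; field_simp
    rw [e1] at m4
    have n1 := b.En_nonneg (F 0 t)
    have n2 := GridData.energy_nonneg b (g N t)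
    have n3 := (abs_le.1 m4).2
    have n4 := abs_nonneg ((g N 0).energy b - b.En (F 0 0))
    have n5 : 0 ≤ c₀ * b.h N := by positivity
    exact abs_le.2 ⟨by linarith, by linarith⟩

theorem Beam.tendsto_h (b : Beam) : Tendsto b.h atTop (𝓝 0) := by
  have : Tendsto (fun N : ℕ => b.L * (1 / ((N : ℝ) + 1))) atTop (𝓝 (b.L * 0)) :=
    tendsto_one_div_add_atTop_nhds_zero_nat.const_mul _
  rw [mul_zero] at this
  exact this.congr fun N => by rw [Beam.h]; ring

end Piezo

/-! ### The rate h^{3/2}√t and uniform convergence -/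

theorem mainTheorem3 (b : Piezo.Beam) (f : Piezo.Field)
    (hreg : f.IsC1C3 b) (hpde : f.SolvesPDE b)
    (g : (N : ℕ) → ℝ → Piezo.GridData N)
    (hg : ∀ N, Piezo.SolvesORFD b (Piezo.Residual.zero N) (f.sample b N 0) (g N))
    (hE0 : Tendsto (fun N => (g N 0).energy b) atTop (𝓝 (f.energy b 0))) :
    (∀ N, ∃ R : Piezo.Residual N, R.IsTruncationError b f ∧
      Piezo.SolvesORFD b R (Piezo.GridData.zero N) (Piezo.errorFun b f (g N))) ∧
    (∃ c : ℝ, 0 < c ∧ ∀ N : ℕ, ∀ t : ℝ, 0 ≤ t →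
      |(g N t).energy b - f.energy b t| ≤
        |(g N 0).energy b - f.energy b 0| + c * b.h N ^ (3 / 2 : ℝ) * Real.sqrt t) ∧
    TendstoUniformlyOn (fun (N : ℕ) (t : ℝ) => (g N t).energy b)
      (fun t => f.energy b t) atTop (Ici 0) := by
  obtain ⟨c, hc, hb⟩ := Piezo.exists_energy_bound hreg hpde hg hE0
  refine ⟨fun N => ?_, ⟨c, hc, fun N t ht => (hb N t ht).trans ?_⟩, ?_⟩
  · obtain ⟨F, l⟩ := hreg.exists_lift
    exact ⟨_, l.isTruncationError hpde N, l.solvesORFD_errorFun hpde (hg N)⟩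
  · have hh := b.h_pos N
    -- With z = √(ht), the claim becomes h·min(z², 1) ≤ h·z, which is clear in the cases z ≤ 1 and z
    -- ≥ 1.
    have e : b.h N ^ (3 / 2 : ℝ) * √t = b.h N * √(b.h N * t) := by
      rw [show (3 / 2 : ℝ) = 1 + 1 / 2 by norm_num, Real.rpow_add hh, Real.rpow_one,
        ← Real.sqrt_eq_rpow, Real.sqrt_mul hh.le, mul_assoc]
    rw [mul_assoc, e]
    gcongr
    have hs := Real.sq_sqrt (mul_nonneg hh.le ht)
    have hs0 := Real.sqrt_nonneg (b.h N * t)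
    rcases le_total (√(b.h N * t)) 1 with h1 | h1
    · refine (min_le_left _ _).trans ?_
      nlinarith [mul_nonneg hh.le (mul_nonneg hs0 (sub_nonneg.2 h1))]
    · exact (min_le_right _ _).trans (le_mul_of_one_le_right hh.le h1)
  · have lim : Tendsto (fun N => |(g N 0).energy b - f.energy b 0| + c * b.h N) atTop (𝓝 0) := by
      simpa using (hE0.sub_const (f.energy b 0)).abs.add (b.tendsto_h.const_mul c)
    rw [Metric.tendstoUniformlyOn_iff]
    intro ε hε
    filter_upwards [lim.eventually_lt_const hε] with N hN t ht
    rw [dist_comm, Real.dist_eq]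
    refine lt_of_le_of_lt ((hb N t ht).trans ?_) hN
    gcongr
    exact min_le_right _ _
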